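/- **Setting.** For a group $G$ and a subset $S\subseteq G$ let $G^+$ be the submonoid generated by $S$. For $a,b\in G^+$ write $a\preceq b$ if $b=ac$ with $c\in G^+$, and $b\succeq a$ if $b=ca$ with $c\in G^+$. For $a,b\in G$ write $a\le b$ if $b=cac'$ with $c,c'\in G^+$. An lcm monoid is a cancellative monoid in which any two elements have a left and a right lcm, and in which for each element $a$ the number of factors in expressions of $a$ as a product of elements $\neq 1$ is bounded. $(G,S)$ is a *Garside system* if $G^+$ is an lcm monoid, $G$ is its group of fractions, and there is $\Delta\in G^+$ whose sets of left and of right divisors in $G^+$ both equal $S$, where $S$ is finite and generates $G$. It is *of spindle type* if for all $a,b\in S$ the left gcd $a\wedge b$ and the right gcd of $a$ and $b$ in $G^+$ lie in $\{a,b,1\}$. Let $X$ be the set of atoms of $G^+$ (elements $a\ne1$ such that $a=bc$ with $b,c\in G^+$ implies $b=1$ or $c=1$). The system has a *homogeneous presentation* if $G$ or $G^+$ admits a presentation $\langle X\mid R_1=R_1',\dots,R_m=R_m'\rangle$ with $R_i,R_i'\in X^*$ and $|R_i|=|R_i'|$. Let $X^-=\{x^{-1}: x\in X\}$ be the set of formal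 inverses and $X^{\pm}=X\cup X^-$. For a word $w\in(X^{\pm})^*$ let $\overline w\in G$ be the element it represents and $|w|$ its length. Let $\tau(a)=\Delta^{-1}a\Delta$, applied letterwise to words. **Normal form.** $\Delta^p s_1\cdots s_l$ is a *left normal form* if $s_i\in S$, $s_i=\Delta\wedge(s_i\cdots s_l)$ for all $i$, $s_l\neq 1$ if $l\ge 1$, and $p$ is the greatest integer $r$ with $\Delta^r\le \Delta^p s_1\cdots s_l$. **Reduction.** Fix a word $D\in X^*$ with $\overline D=\Delta$. For a word $w\in (X^{\pm})^*$ consider a decomposition $w\equiv D^r w_1\cdots w_s$ (equality of words) with $r\in\mathbb Z$, in which each $w_i$ is either *positive*: $w_i\in X^*$ and $\overline{w_i}\in S\setminus\{1,\Delta\}$, or *negative*: $w_i\in(X^-)^*$ and $\overline{w_i}^{\,-1}\in S\setminus\{1,\Delta\}$, and for which $s$ is minimal among all such decompositions of $w$ (over all $r$). The operation $\mathrm{red}$ is defined, up to the choices made, as follows. 1. If $r\ge 0$ or all $w_i$ are negative, then $\mathrm{red}(w)\equiv w$. 2. Otherwise choose a positive $w_k$ whose word length is maximal among the positive $w_i$,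 and a word $w_k'$ of minimal length among the words in $(X^-)^*$ with $\Delta\,\overline{w_k'}=\overline{w_k}$, and put $$\mathrm{red}(w)\equiv D^{r+1}\,\tau(w_1)\cdots\tau(w_{k-1})\,w_k'\,w_{k+1}\cdots w_s .$$ Put $\mathrm{Red}(w)\equiv \mathrm{red}^{|r|}(w)$ with $r$ taken from such a minimal decomposition of $w$. **Lemma.** Let $(G,S)$ with $S=\mathrm{Div}(\Delta)$ be a Garside system of spindle type with homogeneous presentation, and let $X$ be its set of atoms. Let $w_{LNF}\equiv D^p w_1\cdots w_l$ be a word in left normal form, i.e. $D,w_1,\dots,w_l\in X^*$, $\overline D=\Delta$, and $\Delta^p\,\overline{w_1}\cdots\overline{w_l}$ is a left normal form. Then $\mathrm{Red}(w_{LNF})$ has at least one value, and for every possible value $v$ of $\mathrm{Red}(w_{LNF})$ (whatever choices are made), $v\in(X^{\pm})^*$, $\overline v=\overline{w_{LNF}}$, and for all words $w\in(X^{\pm})^*$ with $\overline w=\overline{w_{LNF}}$, $$|v|\le |w| .$$ That is, $\mathrm{Red}(w_{LNF})$ is a geodesic word with respect to $X$. -/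

import Mathlib

namespace SpindleGarside

section Divisibility

variable {G : Type*} [Group G]

/-- `a` is a left divisor of `b` with respect to the submonoid `P`: `b = a * c` for some `c ∈ P`.
For `a b ∈ P` this is left divisibility in the monoid `P`. -/
def LeftDvd (P : Submonoid G) (a b : G) : Prop := ∃ c ∈ P, b = a * c

/-- `a` is a right divisor of `b` with respect to `P`: `b = c * a` for some `c ∈ P`. -/
def RightDvd (P : Submonoid G) (a b : G) : Prop := ∃ c ∈ P, b = c * a

/-- The two-sided order: `a ≤ b` if `b = c * a * c'` with `c, c' ∈ P`. -/
def TwoSidedLE (P : Submonoid G) (a b : G) : Prop := ∃ c ∈ P, ∃ c' ∈ P, b = c * a * c'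

/-- `m` is the right lcm `a ∨ b` of `a` and `b` in the monoid `P`. -/
def IsRightLcm (P : Submonoid G) (a b m : G) : Prop :=
  m ∈ P ∧ LeftDvd P a m ∧ LeftDvd P b m ∧
    ∀ c ∈ P, LeftDvd P a c → LeftDvd P b c → LeftDvd P m c

/-- `m` is the left lcm of `a` and `b` in the monoid `P`. -/
def IsLeftLcm (P : Submonoid G) (a b m : G) : Prop :=
  m ∈ P ∧ RightDvd P a m ∧ RightDvd P b m ∧
    ∀ c ∈ P, RightDvd P a c → RightDvd P b c → RightDvd P m c

/-- `d` is the left gcd `a ∧ b` (greatest common left divisor) of `a` and `b` in `P`. -/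
def IsLeftGcd (P : Submonoid G) (a b d : G) : Prop :=
  d ∈ P ∧ LeftDvd P d a ∧ LeftDvd P d b ∧
    ∀ c ∈ P, LeftDvd P c a → LeftDvd P c b → LeftDvd P c d

/-- `d` is the right gcd (greatest common right divisor) of `a` and `b` in `P`. -/
def IsRightGcd (P : Submonoid G) (a b d : G) : Prop :=
  d ∈ P ∧ RightDvd P d a ∧ RightDvd P d b ∧
    ∀ c ∈ P, RightDvd P c a → RightDvd P c b → RightDvd P c d

/-- `P` is atomic (Noetherian): for every `a ∈ P` there is a bound on the number of factors in
the expressions of `a` as a product of elements of `P` distinct from `1`. -/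
def IsNoetherianMonoid (P : Submonoid G) : Prop :=
  ∀ a ∈ P, ∃ n : ℕ, ∀ l : List G, (∀ x ∈ l, x ∈ P ∧ x ≠ 1) → l.prod = a → l.length ≤ n

/-- `P` is an lcm monoid. Cancellativity is automatic, because `P` is a submonoid of a group. -/
structure IsLcmMonoid (P : Submonoid G) : Prop where
  noetherian : IsNoetherianMonoid P
  exists_rightLcm : ∀ a ∈ P, ∀ b ∈ P, ∃ m, IsRightLcm P a b m
  exists_leftLcm : ∀ a ∈ P, ∀ b ∈ P, ∃ m, IsLeftLcm P a b m

end Divisibility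

section Garside

variable {G : Type*} [Group G]

/-- The monoid `G⁺` generated by `S`. -/
abbrev posMonoid (S : Set G) : Submonoid G := Submonoid.closure S

/-- `(G, S)` is a Garside system with Garside element `Δ`, so that `S = Div(Δ)`. -/
structure IsGarsideSystem (S : Set G) (Δ : G) : Prop where
  lcmMonoid : IsLcmMonoid (posMonoid S)
  fractions : ∀ g : G, ∃ a ∈ posMonoid S, ∃ b ∈ posMonoid S, g = a * b⁻¹
  delta_mem : Δ ∈ posMonoid S
  balanced : ∀ a ∈ posMonoid S, LeftDvd (posMonoid S) a Δ ↔ RightDvd (posMonoid S) a Δ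
  eq_div : S = {a | a ∈ posMonoid S ∧ LeftDvd (posMonoid S) a Δ}
  finite : S.Finite
  generates : Subgroup.closure S = ⊤

/-- Spindle type: for all simple `a`, `b`, the left gcd and the right gcd of `a` and `b`
lie in `{a, b, 1}`. -/
def IsSpindleType (S : Set G) : Prop :=
  ∀ a ∈ S, ∀ b ∈ S,
    (∃ d ∈ ({a, b, 1} : Set G), IsLeftGcd (posMonoid S) a b d) ∧
    (∃ d ∈ ({a, b, 1} : Set G), IsRightGcd (posMonoid S) a b d)

/-- The set `X` of atoms. -/
def atoms (S : Set G) : Set G :=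
  {a | a ∈ posMonoid S ∧ a ≠ 1 ∧
    ∀ b ∈ posMonoid S, ∀ c ∈ posMonoid S, a = b * c → b = 1 ∨ c = 1}

/-- The group `G` admits a finite presentation `⟨X ∣ uᵢ = vᵢ⟩` on the set `X` of atoms with
positive words `uᵢ`, `vᵢ` of equal length. -/
def HasHomogeneousGroupPresentation (S : Set G) : Prop :=
  ∃ R : Set (FreeMonoid (atoms S) × FreeMonoid (atoms S)),
    R.Finite ∧ (∀ r ∈ R, r.1.length = r.2.length) ∧
    ∃ e : PresentedGroup {g : FreeGroup (atoms S) | ∃ r ∈ R,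
        g = FreeMonoid.lift FreeGroup.of r.1 * (FreeMonoid.lift FreeGroup.of r.2)⁻¹} ≃* G,
      ∀ x : atoms S, e (PresentedGroup.of x) = (x : G)

/-- The monoid `G⁺` admits such a presentation (as a monoid). -/
def HasHomogeneousMonoidPresentation (S : Set G) : Prop :=
  ∃ R : Set (FreeMonoid (atoms S) × FreeMonoid (atoms S)),
    R.Finite ∧ (∀ r ∈ R, r.1.length = r.2.length) ∧
    ∃ e : PresentedMonoid (fun u v : FreeMonoid (atoms S) => (u, v) ∈ R) ≃* posMonoid S,
      ∀ x : atoms S, (e (PresentedMonoid.of _ x) : G) = (x : G)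

/-- `G` or `G⁺` admits a homogeneous presentation on the set of atoms. -/
def HasHomogeneousPresentation (S : Set G) : Prop :=
  HasHomogeneousGroupPresentation S ∨ HasHomogeneousMonoidPresentation S

/-- `Δ ^ p * s₁ * ⋯ * sₗ` is a left `Δ`-normal form: the `sᵢ` are simple,
`sᵢ = Δ ∧ (sᵢ ⋯ sₗ)`, `sₗ ≠ 1`, and `p` is the infimum of the element, i.e. the
greatest integer `r` with `Δ ^ r ≤ Δ ^ p * s₁ * ⋯ * sₗ`. -/
structure IsLeftNormalForm (S : Set G) (Δ : G) (p : ℤ) (s : List G) : Prop where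
  simple : ∀ x ∈ s, x ∈ S
  greedy : ∀ (x : G) (t : List G), (x :: t) <:+ s → IsLeftGcd (posMonoid S) Δ (x * t.prod) x
  getLast_ne_one : ∀ h : s ≠ [], s.getLast h ≠ 1
  isGreatest_inf : IsGreatest {r : ℤ | TwoSidedLE (posMonoid S) (Δ ^ r) (Δ ^ p * s.prod)} p

end Garside

section Words

variable {G : Type*} [Group G]

/-- Words in letters `x` (coded as `(x, true)`) and `x⁻¹` (coded as `(x, false)`), `x ∈ G`. -/
abbrev Word (G : Type*) := List (G × Bool)

/-- The group element represented by a word. -/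
def eval (w : Word G) : G := (w.map fun y => if y.2 then y.1 else y.1⁻¹).prod

/-- `w ∈ (X^±)^*`. -/
def IsWord (X : Set G) (w : Word G) : Prop := ∀ y ∈ w, y.1 ∈ X

/-- `w ∈ X^*`. -/
def IsPosWord (X : Set G) (w : Word G) : Prop := ∀ y ∈ w, y.1 ∈ X ∧ y.2 = true

/-- `w ∈ (X^-)^*`. -/
def IsNegWord (X : Set G) (w : Word G) : Prop := ∀ y ∈ w, y.1 ∈ X ∧ y.2 = false

/-- The word `D ^ r`: the concatenation of `|r|` copies of `D`, respectively of the formal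
inverse of `D` if `r < 0`. -/
def wordPow (D : Word G) (r : ℤ) : Word G :=
  (List.replicate r.natAbs (if 0 ≤ r then D else FreeGroup.invRev D)).flatten

/-- The letterwise action of `τ : a ↦ Δ⁻¹ * a * Δ` on words. -/
def tauWord (Δ : G) (w : Word G) : Word G := w.map fun y => (Δ⁻¹ * y.1 * Δ, y.2)

/-- A positive word that represents an element of `S \ {1, Δ}`. -/
def IsPosBlock (S : Set G) (Δ : G) (u : Word G) : Prop :=
  IsPosWord (atoms S) u ∧ eval u ∈ S \ {1, Δ}

/-- A negative word that represents the inverse of an element of `S \ {1, Δ}`. -/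
def IsNegBlock (S : Set G) (Δ : G) (u : Word G) : Prop :=
  IsNegWord (atoms S) u ∧ (eval u)⁻¹ ∈ S \ {1, Δ}

/-- `w ≡ D ^ r w₁ ⋯ wₛ` as words, where `D` is the chosen word for `Δ` and every `wᵢ` is a word
for an element of `(S \ {1, Δ})^±`. -/
def IsDecomposition (S : Set G) (Δ : G) (D w : Word G) (r : ℤ) (L : List (Word G)) : Prop :=
  w = wordPow D r ++ L.flatten ∧ ∀ u ∈ L, IsPosBlock S Δ u ∨ IsNegBlock S Δ u

/-- A decomposition of `w` for which the number `s` of factors `wᵢ` is minimal. -/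
def IsMinDecomposition (S : Set G) (Δ : G) (D w : Word G) (r : ℤ) (L : List (Word G)) : Prop :=
  IsDecomposition S Δ D w r L ∧
    ∀ (r' : ℤ) (L' : List (Word G)), IsDecomposition S Δ D w r' L' → L.length ≤ L'.length

/-- `v` is a word of minimal length among the words in `(X^-)^*` with `Δ * v = u` in `G`. -/
def IsMinNegComplement (S : Set G) (Δ : G) (u v : Word G) : Prop :=
  IsNegWord (atoms S) v ∧ Δ * eval v = eval u ∧
    ∀ v' : Word G, IsNegWord (atoms S) v' → Δ * eval v' = eval u → v.length ≤ v'.length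

/-- `v` is a possible value of `red(w)`: with `w ≡ D ^ r w₁ ⋯ wₛ`, `s` minimal,
either `r ≥ 0` or all `wᵢ` are negative, and `v ≡ w`; or `r < 0`, `w_k` is a positive factor of
maximal word length, and `v ≡ D ^ (r + 1) τ(w₁) ⋯ τ(w_{k-1}) w'_k w_{k+1} ⋯ wₛ`. -/
def RedStep (S : Set G) (Δ : G) (D w v : Word G) : Prop :=
  ∃ (r : ℤ) (L : List (Word G)), IsMinDecomposition S Δ D w r L ∧
    (((0 ≤ r ∨ ∀ u ∈ L, IsNegBlock S Δ u) ∧ v = w) ∨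
      (r < 0 ∧ ∃ (L₁ : List (Word G)) (u : Word G) (L₂ : List (Word G)) (u' : Word G),
        L = L₁ ++ u :: L₂ ∧ IsPosBlock S Δ u ∧
        (∀ x ∈ L, IsPosBlock S Δ x → x.length ≤ u.length) ∧
        IsMinNegComplement S Δ u u' ∧
        v = wordPow D (r + 1) ++ (L₁.map (tauWord Δ)).flatten ++ u' ++ L₂.flatten))

/-- The `n`-fold composition of a relation with itself. -/
def iterRel {α : Type*} (R : α → α → Prop) : ℕ → α → α → Prop
  | 0 => fun a b => a = b
  | n + 1 => fun a b => ∃ c, R a c ∧ iterRel R n c b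

/-- `v` is a possible value of `Red(w) ≡ red^|r|(w)`, where `w ≡ D ^ r w₁ ⋯ wₛ` with `s`
minimal. -/
def IsRed (S : Set G) (Δ : G) (D w v : Word G) : Prop :=
  ∃ (r : ℤ) (L : List (Word G)), IsMinDecomposition S Δ D w r L ∧
    iterRel (RedStep S Δ D) r.natAbs w v

end Words

end SpindleGarside

/-!
In a spindle type system the multiplication of a normal form by a simple element appends a factor,
changes only the last factor, or turns the last product into `Δ` or `Δ * v` and continues with `v`
further left. Two consequences follow. A product of proper simple elements that is not already
normal has a normal form with fewer factors, so the minimal decomposition of any word met in the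
reduction is unique. And multiplying by an atom changes the function `minLength` of the normal form,
the least length obtained by trading factors `a` for `Δ * (a⁻¹ * Δ)⁻¹`, by at most `1`; hence every
word for an element is at least as long as the `minLength` of its normal form.

It remains to see that the reduction attains `minLength`. Let `δ` be the length of `Δ`. Making a
factor of length `a` negative changes the length of the factors by `δ - 2 * a` and the exponent of
`Δ` by `1`, so this is the minimization of `|p| * δ` plus a sum of independent choices, coupled only
by the exponent `p`. Always choosing a longest positive factor makes negative the factors longer
than some threshold `M` and keeps positive the shorter ones, which is optimal for the Lagrange
multiplier `2 * M - δ`. The reduction stops exactly when such a multiplier is a subgradient of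
`p ↦ |p| * δ` at the exponent reached.
-/

namespace SpindleGarside

section Noetherian

variable {G : Type*} [Group G] {P : Submonoid G} {a b c : G}

lemma LeftDvd.trans (hab : LeftDvd P a b) (hbc : LeftDvd P b c) : LeftDvd P a c := by
  obtain ⟨x, hx, rfl⟩ := hab
  obtain ⟨y, hy, rfl⟩ := hbc
  exact ⟨x * y, mul_mem hx hy, mul_assoc a x y⟩

lemma IsNoetherianMonoid.eq_one_of_mul_eq_one (hP : IsNoetherianMonoid P) (ha : a ∈ P)
    (hb : b ∈ P) (hab : a * b = 1) : a = 1 := by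
  by_contra ha1
  obtain rfl : b = a⁻¹ := eq_inv_of_mul_eq_one_right hab
  obtain ⟨n, hn⟩ := hP 1 (one_mem P)
  have hlen := hn (List.replicate (n + 1) a ++ List.replicate (n + 1) a⁻¹)
    (by
      intro x hx
      rcases List.mem_append.1 hx with hx | hx <;> rw [List.eq_of_mem_replicate hx]
      exacts [⟨ha, ha1⟩, ⟨hb, inv_ne_one.2 ha1⟩])
    (by simp)
  simp only [List.length_append, List.length_replicate] at hlen
  omega

lemma IsNoetherianMonoid.leftDvd_antisymm (hP : IsNoetherianMonoid P) (hab : LeftDvd P a b)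
    (hba : LeftDvd P b a) : a = b := by
  obtain ⟨c, hc, rfl⟩ := hab
  obtain ⟨d, hd, had⟩ := hba
  rw [hP.eq_one_of_mul_eq_one hc hd (mul_eq_left.1 (by rw [← mul_assoc, ← had])), mul_one]

lemma IsNoetherianMonoid.rightDvd_antisymm (hP : IsNoetherianMonoid P) (hab : RightDvd P a b)
    (hba : RightDvd P b a) : a = b := by
  obtain ⟨c, hc, rfl⟩ := hab
  obtain ⟨d, hd, had⟩ := hba
  have hdc : d * c = 1 := mul_eq_right.1 (by rw [mul_assoc, ← had])
  rw [eq_inv_of_mul_eq_one_right hdc, hP.eq_one_of_mul_eq_one hd hc hdc, inv_one, one_mul]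

lemma IsNoetherianMonoid.exists_longest_factorization (hP : IsNoetherianMonoid P) (ha : a ∈ P) :
    ∃ l : List G, (∀ x ∈ l, x ∈ P ∧ x ≠ 1) ∧ l.prod = a ∧
      ∀ l' : List G, (∀ x ∈ l', x ∈ P ∧ x ≠ 1) → l'.prod = a → l'.length ≤ l.length := by
  let lengths : Set ℕ := {n | ∃ l : List G, (∀ x ∈ l, x ∈ P ∧ x ≠ 1) ∧ l.prod = a ∧ l.length = n}
  have hne : lengths.Nonempty := by
    rcases eq_or_ne a 1 with rfl | ha1
    · exact ⟨0, [], by simp⟩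
    · exact ⟨1, [a], by simp [ha, ha1]⟩
  have hbdd : BddAbove lengths := by
    obtain ⟨n, hn⟩ := hP a ha
    exact ⟨n, fun _ ⟨l, hl, hla, hlen⟩ => hlen ▸ hn l hl hla⟩
  obtain ⟨l, hl, hla, hlen⟩ := Nat.sSup_mem hne hbdd
  exact ⟨l, hl, hla, fun l' hl' hla' => hlen ▸ le_csSup hbdd ⟨l', hl', hla', rfl⟩⟩

end Noetherian

section Words

variable {G : Type*} {X : Set G} {u v w : Word G} {y : G × Bool}

lemma IsPosWord.isWord (hw : IsPosWord X w) : IsWord X w := fun y hy => (hw y hy).1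

lemma IsNegWord.isWord (hw : IsNegWord X w) : IsWord X w := fun y hy => (hw y hy).1

lemma isWord_append : IsWord X (u ++ v) ↔ IsWord X u ∧ IsWord X v := List.forall_mem_append

lemma isPosWord_cons : IsPosWord X (y :: w) ↔ (y.1 ∈ X ∧ y.2 = true) ∧ IsPosWord X w :=
  List.forall_mem_cons

lemma IsPosWord.isNegWord_invRev (hw : IsPosWord X w) : IsNegWord X (FreeGroup.invRev w) := by
  intro y hy
  obtain ⟨z, hz, rfl⟩ := List.mem_map.1 (List.mem_reverse.1 hy)
  exact ⟨(hw z hz).1, by simp [(hw z hz).2]⟩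

lemma IsNegWord.isPosWord_invRev (hw : IsNegWord X w) : IsPosWord X (FreeGroup.invRev w) := by
  intro y hy
  obtain ⟨z, hz, rfl⟩ := List.mem_map.1 (List.mem_reverse.1 hy)
  exact ⟨(hw z hz).1, by simp [(hw z hz).2]⟩

lemma IsPosWord.isWord_wordPow (hw : IsPosWord X w) (r : ℤ) : IsWord X (wordPow w r) := by
  intro y hy
  obtain ⟨u, hu, hyu⟩ := List.mem_flatten.1 hy
  rw [List.eq_of_mem_replicate hu] at hyu
  split_ifs at hyu
  exacts [hw.isWord y hyu, hw.isNegWord_invRev.isWord y hyu]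

@[simp]
lemma length_wordPow (w : Word G) (r : ℤ) : (wordPow w r).length = r.natAbs * w.length := by
  simp only [wordPow, List.length_flatten, List.map_replicate, List.sum_replicate, smul_eq_mul]
  split_ifs <;> simp [FreeGroup.invRev_length]

end Words

section Eval

variable {G : Type*} [Group G]

@[simp]
lemma eval_nil : eval ([] : Word G) = 1 := rfl

@[simp]
lemma eval_append (u v : Word G) : eval (u ++ v) = eval u * eval v := by
  simp [eval]

lemma eval_cons (y : G × Bool) (w : Word G) :
    eval (y :: w) = (if y.2 then y.1 else y.1⁻¹) * eval w := by
  simp [eval]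

lemma eval_flatten (L : List (Word G)) : eval L.flatten = (L.map eval).prod := by
  induction L with
  | nil => rfl
  | cons u L ih => simp [ih]

@[simp]
lemma eval_invRev (w : Word G) : eval (FreeGroup.invRev w) = (eval w)⁻¹ := by
  simp only [eval, FreeGroup.invRev, List.map_reverse, List.map_map, List.prod_inv_reverse]
  congr 3
  ext ⟨x, b⟩
  cases b <;> simp

@[simp]
lemma eval_wordPow (w : Word G) (r : ℤ) : eval (wordPow w r) = eval w ^ r := by
  rw [wordPow, eval_flatten, List.map_replicate, List.prod_replicate]
  split_ifs with hr
  · rw [← zpow_natCast, Int.natAbs_of_nonneg hr]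
  · rw [eval_invRev, inv_pow, ← zpow_natCast, Int.ofNat_natAbs_of_nonpos (by omega), zpow_neg,
      inv_inv]

lemma IsPosWord.eval_mem_closure {X : Set G} {w : Word G} (hw : IsPosWord X w) :
    eval w ∈ Submonoid.closure X := by
  refine list_prod_mem fun x hx => ?_
  obtain ⟨y, hy, rfl⟩ := List.mem_map.1 hx
  simpa [(hw y hy).2] using Submonoid.subset_closure (hw y hy).1

end Eval

section LengthFunction

variable {G : Type*} [Group G] {S : Set G} {ℓ : G → ℤ} {w : Word G}

lemma closure_atoms_le : Submonoid.closure (atoms S) ≤ posMonoid S :=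
  Submonoid.closure_le.2 fun _ hx => hx.1

lemma exists_isPosWord_eval_eq (hP : IsNoetherianMonoid (posMonoid S)) {a : G}
    (ha : a ∈ posMonoid S) : ∃ w, IsPosWord (atoms S) w ∧ eval w = a := by
  obtain ⟨l, hl, rfl, hmax⟩ := hP.exists_longest_factorization ha
  have hatoms : ∀ x ∈ l, x ∈ atoms S := by
    refine fun x hx => ⟨(hl x hx).1, (hl x hx).2, fun b hb c hc hbc => ?_⟩
    by_contra! hne
    obtain ⟨l₁, l₂, rfl⟩ := List.append_of_mem hx
    simp only [List.forall_mem_append, List.forall_mem_cons] at hl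
    have := hmax (l₁ ++ b :: c :: l₂)
      (by simpa only [List.forall_mem_append, List.forall_mem_cons] using
        ⟨hl.1, ⟨hb, hne.1⟩, ⟨hc, hne.2⟩, hl.2.2⟩)
      (by simp [hbc, mul_assoc])
    simp only [List.length_append, List.length_cons] at this
    omega
  refine ⟨l.map fun x => (x, true), fun y hy => ?_, by simp [eval, Function.comp_def]⟩
  obtain ⟨x, hx, rfl⟩ := List.mem_map.1 hy
  exact ⟨hatoms x hx, rfl⟩

/-- An additive length function on the monoid `G⁺` with value `1` on the atoms; its values outside
`G⁺` are irrelevant. It is integer-valued because it is used inside signed expressions. -/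
structure IsLengthFun (S : Set G) (ℓ : G → ℤ) : Prop where
  map_mul : ∀ a ∈ posMonoid S, ∀ b ∈ posMonoid S, ℓ (a * b) = ℓ a + ℓ b
  atom : ∀ x ∈ atoms S, ℓ x = 1

lemma HasHomogeneousGroupPresentation.exists_isLengthFun (h : HasHomogeneousGroupPresentation S) :
    ∃ ℓ : G → ℤ, IsLengthFun S ℓ := by
  obtain ⟨R, -, hlen, e, he⟩ := h
  let f : atoms S → Multiplicative ℤ := fun _ => Multiplicative.ofAdd 1
  have lift_word (u : FreeMonoid (atoms S)) : FreeGroup.lift f (FreeMonoid.lift FreeGroup.of u) =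
      Multiplicative.ofAdd (u.length : ℤ) := by
    induction u using FreeMonoid.inductionOn' with
    | one => simp
    | of_mul x u ih => simp [ih, f, ofAdd_add]
  have lift_relator : ∀ g ∈ {g : FreeGroup (atoms S) | ∃ r ∈ R,
      g = FreeMonoid.lift FreeGroup.of r.1 * (FreeMonoid.lift FreeGroup.of r.2)⁻¹},
      FreeGroup.lift f g = 1 := by
    rintro g ⟨r, hr, rfl⟩
    rw [_root_.map_mul, map_inv, lift_word, lift_word, hlen r hr, mul_inv_cancel]
  refine ⟨fun g => (PresentedGroup.toGroup lift_relator (e.symm g)).toAdd,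
    fun a _ b _ => by simp, fun x hx => ?_⟩
  have hex : e.symm x = PresentedGroup.of (⟨x, hx⟩ : atoms S) := by
    rw [MulEquiv.symm_apply_eq, he]
  simp only [hex, PresentedGroup.toGroup.of, f, toAdd_ofAdd]

lemma HasHomogeneousMonoidPresentation.exists_isLengthFun
    (h : HasHomogeneousMonoidPresentation S) : ∃ ℓ : G → ℤ, IsLengthFun S ℓ := by
  classical
  obtain ⟨R, -, hlen, e, he⟩ := h
  let f : atoms S → Multiplicative ℤ := fun _ => Multiplicative.ofAdd 1
  have lift_word (u : FreeMonoid (atoms S)) :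
      FreeMonoid.lift f u = Multiplicative.ofAdd (u.length : ℤ) := by
    induction u using FreeMonoid.inductionOn' with
    | one => simp
    | of_mul x u ih => simp [ih, f, ofAdd_add]
  have lift_relation (u v : FreeMonoid (atoms S)) (huv : (u, v) ∈ R) :
      FreeMonoid.lift f u = FreeMonoid.lift f v := by
    rw [lift_word, lift_word, hlen _ huv]
  refine ⟨fun g => if hg : g ∈ posMonoid S then
    (PresentedMonoid.lift f lift_relation (e.symm ⟨g, hg⟩)).toAdd else 0,
    fun a ha b hb => ?_, fun x hx => ?_⟩
  · simp only [ha, hb, mul_mem ha hb, dif_pos]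
    rw [← toAdd_mul, ← _root_.map_mul, ← _root_.map_mul]
    rfl
  · have hex : e.symm ⟨x, hx.1⟩ = PresentedMonoid.of _ (⟨x, hx⟩ : atoms S) := by
      rw [MulEquiv.symm_apply_eq]
      exact Subtype.ext (he ⟨x, hx⟩).symm
    simp only [hx.1, dif_pos, hex, PresentedMonoid.lift_of, f, toAdd_ofAdd]

lemma HasHomogeneousPresentation.exists_isLengthFun (h : HasHomogeneousPresentation S) :
    ∃ ℓ : G → ℤ, IsLengthFun S ℓ :=
  h.elim HasHomogeneousGroupPresentation.exists_isLengthFun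
    HasHomogeneousMonoidPresentation.exists_isLengthFun

namespace IsLengthFun

lemma map_one (hℓ : IsLengthFun S ℓ) : ℓ 1 = 0 := by
  simpa using hℓ.map_mul 1 (one_mem _) 1 (one_mem _)

lemma map_eval_pos (hℓ : IsLengthFun S ℓ) (hw : IsPosWord (atoms S) w) :
    ℓ (eval w) = w.length := by
  induction w with
  | nil => simp [hℓ.map_one]
  | cons y w ih =>
    rw [isPosWord_cons] at hw
    rw [eval_cons, if_pos hw.1.2,
      hℓ.map_mul _ hw.1.1.1 _ (closure_atoms_le hw.2.eval_mem_closure), ih hw.2, hℓ.atom _ hw.1.1,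
      List.length_cons, Nat.cast_add_one, add_comm]

lemma map_inv_eval_neg (hℓ : IsLengthFun S ℓ) (hw : IsNegWord (atoms S) w) :
    ℓ (eval w)⁻¹ = w.length := by
  rw [← eval_invRev, hℓ.map_eval_pos hw.isPosWord_invRev, FreeGroup.invRev_length]

lemma pos (hℓ : IsLengthFun S ℓ) (hP : IsNoetherianMonoid (posMonoid S)) {a : G}
    (ha : a ∈ posMonoid S) (ha1 : a ≠ 1) : 0 < ℓ a := by
  obtain ⟨w, hw, rfl⟩ := exists_isPosWord_eval_eq hP ha
  have hw0 : w ≠ [] := by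
    rintro rfl
    exact ha1 eval_nil
  rw [hℓ.map_eval_pos hw]
  exact_mod_cast List.length_pos_iff.2 hw0

end IsLengthFun

end LengthFunction

section NormalForms

variable {G : Type*} [Group G] {S : Set G} {Δ : G}

/-- A Garside system without the finiteness and generation conditions: `G⁺` is an lcm monoid and
`S` is the common set of left and right divisors of `Δ`. -/
structure IsQuasiGarsideSystem (S : Set G) (Δ : G) : Prop where
  lcmMonoid : IsLcmMonoid (posMonoid S)
  delta_mem_pos : Δ ∈ posMonoid S
  balanced : ∀ a ∈ posMonoid S, LeftDvd (posMonoid S) a Δ ↔ RightDvd (posMonoid S) a Δ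
  eq_div : S = {a | a ∈ posMonoid S ∧ LeftDvd (posMonoid S) a Δ}

lemma IsGarsideSystem.isQuasiGarsideSystem (hG : IsGarsideSystem S Δ) :
    IsQuasiGarsideSystem S Δ :=
  ⟨hG.lcmMonoid, hG.delta_mem, hG.balanced, hG.eq_div⟩

lemma mem_diff_pair_iff {a : G} : a ∈ S \ {1, Δ} ↔ a ∈ S ∧ a ≠ 1 ∧ a ≠ Δ := by
  simp only [Set.mem_sdiff, Set.mem_insert_iff, Set.mem_singleton_iff, not_or, ne_eq]

lemma mem_posMonoid {a : G} (ha : a ∈ S) : a ∈ posMonoid S := Submonoid.subset_closure ha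

lemma prod_mem_posMonoid {T : Set G} {t : List G} (ht : ∀ x ∈ t, x ∈ S \ T) :
    t.prod ∈ posMonoid S :=
  list_prod_mem fun x hx => mem_posMonoid (ht x hx).1

lemma mem_of_mem_atoms {a : G} (ha : a ∈ atoms S) : a ∈ S := by
  obtain ⟨l, hl, hla⟩ := Submonoid.exists_list_of_mem_closure ha.1
  induction l generalizing a with
  | nil => exact absurd hla.symm ha.2.1
  | cons x l ih =>
    have hlP : l.prod ∈ posMonoid S := list_prod_mem fun y hy => mem_posMonoid (hl y (by simp [hy]))
    rw [List.prod_cons] at hla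
    rcases ha.2.2 x (mem_posMonoid (hl x (by simp))) _ hlP hla.symm with hx | hl1
    · exact ih ha (fun y hy => hl y (by simp [hy])) (by rw [← hla, hx, one_mul])
    · rw [← hla, hl1, mul_one]
      exact hl x (by simp)

namespace IsQuasiGarsideSystem

variable (hG : IsQuasiGarsideSystem S Δ)
include hG

section Divisors

variable {a b : G}

lemma noetherian : IsNoetherianMonoid (posMonoid S) := hG.lcmMonoid.noetherian

lemma mem_iff_leftDvd : a ∈ S ↔ a ∈ posMonoid S ∧ LeftDvd (posMonoid S) a Δ :=
  Set.ext_iff.1 hG.eq_div a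

lemma mem_iff_rightDvd : a ∈ S ↔ a ∈ posMonoid S ∧ RightDvd (posMonoid S) a Δ :=
  hG.mem_iff_leftDvd.trans (and_congr_right (hG.balanced a))

lemma delta_mem : Δ ∈ S := hG.mem_iff_leftDvd.2 ⟨hG.delta_mem_pos, 1, one_mem _, by simp⟩

lemma mem_of_leftDvd (ha : a ∈ posMonoid S) (hb : b ∈ S) (hab : LeftDvd (posMonoid S) a b) :
    a ∈ S :=
  hG.mem_iff_leftDvd.2 ⟨ha, hab.trans (hG.mem_iff_leftDvd.1 hb).2⟩

lemma mem_of_rightDvd (ha : a ∈ posMonoid S) (hb : b ∈ S) (hab : RightDvd (posMonoid S) a b) :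
    a ∈ S := by
  obtain ⟨c, hc, rfl⟩ := hab
  obtain ⟨d, hd, hΔ⟩ := (hG.mem_iff_rightDvd.1 hb).2
  exact hG.mem_iff_rightDvd.2 ⟨ha, d * c, mul_mem hd hc, by rw [hΔ, mul_assoc]⟩

lemma eq_delta_of_leftDvd (ha : a ∈ S) (hΔa : LeftDvd (posMonoid S) Δ a) : a = Δ :=
  hG.noetherian.leftDvd_antisymm (hG.mem_iff_leftDvd.1 ha).2 hΔa

lemma eq_delta_of_rightDvd (ha : a ∈ S) (hΔa : RightDvd (posMonoid S) Δ a) : a = Δ :=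
  hG.noetherian.rightDvd_antisymm (hG.mem_iff_rightDvd.1 ha).2 hΔa

lemma inv_mul_delta_mem (ha : a ∈ S) : a⁻¹ * Δ ∈ S := by
  obtain ⟨haP, c, hc, hΔ⟩ := hG.mem_iff_leftDvd.1 ha
  rw [hΔ, inv_mul_cancel_left]
  exact hG.mem_iff_rightDvd.2 ⟨hc, a, haP, hΔ⟩

lemma delta_mul_inv_mem (ha : a ∈ S) : Δ * a⁻¹ ∈ S := by
  obtain ⟨haP, c, hc, hΔ⟩ := hG.mem_iff_rightDvd.1 ha
  rw [hΔ, mul_inv_cancel_right]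
  exact hG.mem_iff_leftDvd.2 ⟨hc, a, haP, hΔ⟩

lemma inv_mul_delta_mem_proper (ha : a ∈ S \ {1, Δ}) : a⁻¹ * Δ ∈ S \ {1, Δ} := by
  obtain ⟨haS, ha1, haΔ⟩ := mem_diff_pair_iff.1 ha
  exact mem_diff_pair_iff.2 ⟨hG.inv_mul_delta_mem haS, fun h => haΔ (inv_mul_eq_one.1 h),
    fun h => ha1 (by simpa using h)⟩

lemma delta_mul_inv_mem_proper (ha : a ∈ S \ {1, Δ}) : Δ * a⁻¹ ∈ S \ {1, Δ} := by
  obtain ⟨haS, ha1, haΔ⟩ := mem_diff_pair_iff.1 ha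
  exact mem_diff_pair_iff.2 ⟨hG.delta_mul_inv_mem haS, fun h => haΔ (mul_inv_eq_one.1 h).symm,
    fun h => ha1 (by simpa using h)⟩

end Divisors

end IsQuasiGarsideSystem

section Twist

/-- Conjugation `a ↦ Δ ^ k * a * Δ ^ (-k)`, so that `τ` of the paper is `twist Δ (-1)`. -/
def twist (Δ : G) (k : ℤ) : G ≃* G := MulAut.conj (Δ ^ k)

lemma twist_apply (k : ℤ) (a : G) : twist Δ k a = Δ ^ k * a * (Δ ^ k)⁻¹ := rfl

lemma twist_neg_one (a : G) : twist Δ (-1) a = Δ⁻¹ * a * Δ := by simp [twist_apply]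

@[simp]
lemma twist_zero (a : G) : twist Δ 0 a = a := by simp [twist_apply]

@[simp]
lemma twist_twist (j k : ℤ) (a : G) : twist Δ j (twist Δ k a) = twist Δ (j + k) a := by
  simp only [twist_apply, zpow_add]
  group

@[simp]
lemma twist_delta (k : ℤ) : twist Δ k Δ = Δ := by
  rw [twist_apply]
  group

lemma twist_mul_zpow (k : ℤ) (a : G) : twist Δ k a * Δ ^ k = Δ ^ k * a :=
  inv_mul_cancel_right _ _

lemma eval_tauWord (w : Word G) : eval (tauWord Δ w) = twist Δ (-1) (eval w) := by
  rw [eval, eval, map_list_prod, tauWord, List.map_map, List.map_map]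
  congr 2
  ext ⟨x, b⟩
  cases b <;> simp [twist_neg_one, mul_assoc]

namespace IsQuasiGarsideSystem

variable (hG : IsQuasiGarsideSystem S Δ) {a b : G}
include hG

lemma twist_mem {a : G} (ha : a ∈ S) (k : ℤ) : twist Δ k a ∈ S := by
  induction k generalizing a with
  | zero => simpa using ha
  | succ k ih =>
    have hstep : twist Δ 1 a = Δ * (Δ * a⁻¹)⁻¹ := by simp [twist_apply, mul_assoc]
    rw [← twist_twist, hstep]
    exact ih (hG.delta_mul_inv_mem (hG.delta_mul_inv_mem ha))
  | pred k ih =>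
    have hstep : twist Δ (-1) a = (a⁻¹ * Δ)⁻¹ * Δ := by simp [twist_apply]
    rw [sub_eq_add_neg, ← twist_twist, hstep]
    exact ih (hG.inv_mul_delta_mem (hG.inv_mul_delta_mem ha))

lemma twist_mem_iff (k : ℤ) : twist Δ k a ∈ S ↔ a ∈ S :=
  ⟨fun h => by simpa using hG.twist_mem h (-k), fun h => hG.twist_mem h k⟩

lemma twist_mem_pos (ha : a ∈ posMonoid S) (k : ℤ) : twist Δ k a ∈ posMonoid S := by
  have hle : posMonoid S ≤ (posMonoid S).comap (twist Δ k) :=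
    Submonoid.closure_le.2 fun x hx => mem_posMonoid (hG.twist_mem hx k)
  exact hle ha

lemma twist_mem_proper_iff (k : ℤ) : twist Δ k a ∈ S \ {1, Δ} ↔ a ∈ S \ {1, Δ} := by
  have hΔ : twist Δ k a = Δ ↔ a = Δ := by
    rw [← (twist Δ k).injective.eq_iff (a := a), twist_delta]
  rw [mem_diff_pair_iff, mem_diff_pair_iff, hG.twist_mem_iff, Ne, EmbeddingLike.map_eq_one_iff,
    Ne, hΔ]

lemma twist_mem_atoms (ha : a ∈ atoms S) (k : ℤ) : twist Δ k a ∈ atoms S := by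
  refine ⟨hG.twist_mem_pos ha.1 k, by simpa using ha.2.1, fun b hb c hc habc => ?_⟩
  have := ha.2.2 _ (hG.twist_mem_pos hb (-k)) _ (hG.twist_mem_pos hc (-k))
    (by rw [← _root_.map_mul, ← habc, twist_twist, neg_add_cancel, twist_zero])
  simpa using this

lemma leftDvd_twist (k : ℤ) (hab : LeftDvd (posMonoid S) a b) :
    LeftDvd (posMonoid S) (twist Δ k a) (twist Δ k b) := by
  obtain ⟨c, hc, rfl⟩ := hab
  exact ⟨twist Δ k c, hG.twist_mem_pos hc k, map_mul _ _ _⟩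

end IsQuasiGarsideSystem

end Twist

namespace IsLengthFun

variable {ℓ : G → ℤ} (hℓ : IsLengthFun S ℓ) (hG : IsQuasiGarsideSystem S Δ) {a : G}
include hℓ hG

lemma map_twist (ha : a ∈ posMonoid S) (k : ℤ) : ℓ (twist Δ k a) = ℓ a := by
  have natCase {b : G} (hb : b ∈ posMonoid S) (n : ℕ) : ℓ (twist Δ n b) = ℓ b := by
    have hΔn := pow_mem hG.delta_mem_pos n
    have hcomm := congrArg ℓ (twist_mul_zpow (Δ := Δ) n b)
    rw [zpow_natCast, hℓ.map_mul _ (hG.twist_mem_pos hb n) _ hΔn, hℓ.map_mul _ hΔn _ hb] at hcomm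
    omega
  obtain ⟨n, rfl | rfl⟩ := k.eq_nat_or_neg
  · exact natCase ha n
  · rw [← natCase (hG.twist_mem_pos ha _) n, twist_twist, add_neg_cancel, twist_zero]

lemma map_inv_mul_delta (ha : a ∈ S) : ℓ (a⁻¹ * Δ) = ℓ Δ - ℓ a := by
  have h := hℓ.map_mul a (mem_posMonoid ha) _ (mem_posMonoid (hG.inv_mul_delta_mem ha))
  rw [mul_inv_cancel_left] at h
  omega

lemma map_delta_mul_inv (ha : a ∈ S) : ℓ (Δ * a⁻¹) = ℓ Δ - ℓ a := by
  have h := hℓ.map_mul _ (mem_posMonoid (hG.delta_mul_inv_mem ha)) a (mem_posMonoid ha)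
  rw [inv_mul_cancel_right] at h
  omega

end IsLengthFun

section NormalLists

/-- The pair `(a, b)` is greedy: no nontrivial left divisor of `b` can be moved into `a`. -/
def Greedy (S : Set G) (a b : G) : Prop :=
  ∀ c ∈ posMonoid S, LeftDvd (posMonoid S) c b → a * c ∈ S → c = 1

/-- The list of simple factors of a left normal form, described by the local condition that
consecutive factors form greedy pairs. -/
structure IsNormalList (S : Set G) (Δ : G) (t : List G) : Prop where
  proper : ∀ x ∈ t, x ∈ S \ {1, Δ}
  isChain : t.IsChain (Greedy S)

lemma isNormalList_nil : IsNormalList S Δ [] := ⟨by simp, by simp⟩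

lemma IsNormalList.tail {a : G} {t : List G} (ht : IsNormalList S Δ (a :: t)) :
    IsNormalList S Δ t :=
  ⟨fun x hx => ht.proper x (List.mem_cons_of_mem a hx), ht.isChain.tail⟩

lemma isNormalList_append_singleton {t : List G} {a : G} : IsNormalList S Δ (t ++ [a]) ↔
    IsNormalList S Δ t ∧ a ∈ S \ {1, Δ} ∧ ∀ x ∈ t.getLast?, Greedy S x a := by
  constructor
  · rintro ⟨hprop, hchain⟩
    rw [List.isChain_append] at hchain
    exact ⟨⟨fun x hx => hprop x (by simp [hx]), hchain.1⟩, hprop a (by simp),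
      fun x hx => hchain.2.2 x hx a rfl⟩
  · rintro ⟨ht, ha, hgreedy⟩
    refine ⟨List.forall_mem_append.2 ⟨ht.proper, by simpa using ha⟩,
      List.isChain_append.2 ⟨ht.isChain, List.isChain_singleton a, ?_⟩⟩
    rintro x hx y ⟨⟩
    exact hgreedy x hx

lemma prod_map_twist (k : ℤ) (t : List G) :
    (t.map (twist Δ k)).prod = twist Δ k t.prod :=
  (map_list_prod _ _).symm

lemma Greedy.twist (hG : IsQuasiGarsideSystem S Δ) {a b : G} (hab : Greedy S a b) (k : ℤ) :
    Greedy S (twist Δ k a) (twist Δ k b) := by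
  intro c hc hcb hac
  have hc1 := hab (SpindleGarside.twist Δ (-k) c) (hG.twist_mem_pos hc (-k))
    (by simpa using hG.leftDvd_twist (-k) hcb) (by simpa using hG.twist_mem hac (-k))
  simpa using hc1

/-- The lcm of `c` and `a` is a simple multiple `a * d` of `a`, where `d` divides `y`; hence `d`
divides `b`, and greediness forces `d = 1`. -/
lemma Greedy.leftDvd_of_leftDvd_mul (hG : IsQuasiGarsideSystem S Δ) {a b c y : G}
    (hab : Greedy S a b) (ha : a ∈ S) (hc : c ∈ S) (hy : y ∈ posMonoid S)
    (hyb : ∀ d ∈ S, LeftDvd (posMonoid S) d y → LeftDvd (posMonoid S) d b)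
    (hcay : LeftDvd (posMonoid S) c (a * y)) : LeftDvd (posMonoid S) c a := by
  have haP := mem_posMonoid ha
  obtain ⟨m, hm, hcm, ⟨d, hd, rfl⟩, hmin⟩ :=
    hG.lcmMonoid.exists_rightLcm c (mem_posMonoid hc) a haP
  have hadS : a * d ∈ S := hG.mem_iff_leftDvd.2
    ⟨hm, hmin _ hG.delta_mem_pos (hG.mem_iff_leftDvd.1 hc).2 (hG.mem_iff_leftDvd.1 ha).2⟩
  obtain ⟨e, he, hye⟩ := hmin _ (mul_mem haP hy) hcay ⟨y, hy, rfl⟩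
  have hdy : LeftDvd (posMonoid S) d y := ⟨e, he, mul_left_cancel (hye.trans (mul_assoc a d e))⟩
  have hdS : d ∈ S := hG.mem_of_rightDvd hd hadS ⟨a, haP, rfl⟩
  rwa [hab d hd (hyb d hdS hdy) hadS, mul_one] at hcm

namespace IsNormalList

variable (hG : IsQuasiGarsideSystem S Δ)
include hG

lemma map_twist {t : List G} (ht : IsNormalList S Δ t) (k : ℤ) :
    IsNormalList S Δ (t.map (twist Δ k)) := by
  refine ⟨fun x hx => ?_, ?_⟩
  · obtain ⟨y, hy, rfl⟩ := List.mem_map.1 hx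
    exact (hG.twist_mem_proper_iff k).2 (ht.proper y hy)
  · rw [List.isChain_map]
    exact ht.isChain.imp fun a b hab => hab.twist hG k

lemma leftDvd_head {a c : G} {t : List G} (ht : IsNormalList S Δ (a :: t)) (hc : c ∈ S)
    (hcat : LeftDvd (posMonoid S) c (a :: t).prod) : LeftDvd (posMonoid S) c a := by
  induction t generalizing a c with
  | nil => simpa using hcat
  | cons b t ih =>
    rw [List.prod_cons] at hcat
    exact (List.isChain_cons_cons.1 ht.isChain).1.leftDvd_of_leftDvd_mul hG
      (ht.proper a (by simp)).1 hc (prod_mem_posMonoid ht.tail.proper)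
      (fun d hd hdy => ih ht.tail hd hdy) hcat

lemma not_delta_leftDvd {t : List G} (ht : IsNormalList S Δ t) (hΔ : Δ ≠ 1) :
    ¬ LeftDvd (posMonoid S) Δ t.prod := by
  intro hΔt
  cases t with
  | nil =>
    obtain ⟨c, hc, h1⟩ := hΔt
    exact hΔ (hG.noetherian.eq_one_of_mul_eq_one hG.delta_mem_pos hc h1.symm)
  | cons a t =>
    have ha := mem_diff_pair_iff.1 (ht.proper a (by simp))
    exact ha.2.2 (hG.eq_delta_of_leftDvd ha.1 (ht.leftDvd_head hG hG.delta_mem hΔt))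

lemma eq_nil_of_prod_eq_one {t : List G} (ht : IsNormalList S Δ t) (h1 : t.prod = 1) :
    t = [] := by
  cases t with
  | nil => rfl
  | cons a t =>
    have ha := mem_diff_pair_iff.1 (ht.proper a (by simp))
    exact absurd (hG.noetherian.eq_one_of_mul_eq_one (mem_posMonoid ha.1)
      (prod_mem_posMonoid ht.tail.proper) h1) ha.2.1

lemma eq_of_prod_eq {t t' : List G} (ht : IsNormalList S Δ t) (ht' : IsNormalList S Δ t')
    (hprod : t.prod = t'.prod) : t = t' := by
  induction t generalizing t' with
  | nil => exact (ht'.eq_nil_of_prod_eq_one hG hprod.symm).symm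
  | cons a t ih =>
    cases t' with
    | nil => exact ht.eq_nil_of_prod_eq_one hG hprod
    | cons b t' =>
      have hab : LeftDvd (posMonoid S) a b := ht'.leftDvd_head hG (ht.proper a (by simp)).1
        ⟨t.prod, prod_mem_posMonoid ht.tail.proper, by rw [← hprod, List.prod_cons]⟩
      have hba : LeftDvd (posMonoid S) b a := ht.leftDvd_head hG (ht'.proper b (by simp)).1
        ⟨t'.prod, prod_mem_posMonoid ht'.tail.proper, by rw [hprod, List.prod_cons]⟩
      obtain rfl := hG.noetherian.leftDvd_antisymm hab hba
      rw [List.prod_cons, List.prod_cons, mul_right_inj] at hprod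
      rw [ih ht.tail ht'.tail hprod]

lemma exponent_le (hΔ : Δ ≠ 1) {t t' : List G} (ht : IsNormalList S Δ t)
    (ht' : IsNormalList S Δ t') {p q : ℤ} (h : Δ ^ p * t.prod = Δ ^ q * t'.prod) : q ≤ p := by
  by_contra! hlt
  obtain ⟨k, rfl⟩ : ∃ k : ℕ, q = p + (k + 1 : ℕ) := ⟨(q - p - 1).toNat, by omega⟩
  rw [zpow_add, mul_assoc, mul_right_inj, zpow_natCast, pow_succ', mul_assoc] at h
  exact ht.not_delta_leftDvd hG hΔ
    ⟨_, mul_mem (pow_mem hG.delta_mem_pos k) (prod_mem_posMonoid ht'.proper), h⟩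

lemma unique (hΔ : Δ ≠ 1) {t t' : List G} (ht : IsNormalList S Δ t) (ht' : IsNormalList S Δ t')
    {p q : ℤ} (h : Δ ^ p * t.prod = Δ ^ q * t'.prod) : p = q ∧ t = t' := by
  obtain rfl : p = q :=
    le_antisymm (ht'.exponent_le hG hΔ ht h.symm) (ht.exponent_le hG hΔ ht' h)
  exact ⟨rfl, ht.eq_of_prod_eq hG ht' (mul_left_cancel h)⟩

end IsNormalList

end NormalLists

section LeftNormalForm

namespace IsLeftNormalForm

variable {p : ℤ} {s : List G} (hs : IsLeftNormalForm S Δ p s)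
include hs

lemma delta_ne_one : Δ ≠ 1 := by
  rintro rfl
  have hle : TwoSidedLE (posMonoid S) ((1 : G) ^ p) (1 ^ p * s.prod) := hs.isGreatest_inf.1
  have : p + 1 ≤ p := hs.isGreatest_inf.2 (by simpa using hle)
  omega

lemma delta_notMem (hG : IsQuasiGarsideSystem S Δ) : Δ ∉ s := by
  intro hΔs
  obtain ⟨t, t', rfl⟩ := List.append_of_mem hΔs
  have mem_pos {u : List G} (hu : u ⊆ t ++ Δ :: t') : u.prod ∈ posMonoid S :=
    list_prod_mem fun x hx => mem_posMonoid (hs.simple x (hu hx))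
  have : p + 1 ≤ p := hs.isGreatest_inf.2 ⟨1, one_mem _, twist Δ (-1) t.prod * t'.prod,
    mul_mem (hG.twist_mem_pos (mem_pos (by simp)) _) (mem_pos (by simp)), by
      rw [twist_neg_one, List.prod_append, List.prod_cons]
      group⟩
  omega

/-- A factor `1` would force the next factor to be `1`, and so on up to the last one. -/
lemma one_notMem (hG : IsQuasiGarsideSystem S Δ) : 1 ∉ s := by
  have not_suffix (t : List G) : ¬ (1 :: t) <:+ s := by
    induction t with
    | nil =>
      rintro ⟨r, rfl⟩
      exact hs.getLast_ne_one (by simp) (by simp)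
    | cons b t ih =>
      intro hsuffix
      have hmem : ∀ x ∈ b :: t, x ∈ posMonoid S := fun x hx =>
        mem_posMonoid (hs.simple x (hsuffix.subset (List.mem_cons_of_mem 1 hx)))
      have hbS : b ∈ S := hs.simple b (hsuffix.subset (by simp))
      obtain ⟨c, hc, hbc⟩ := (hs.greedy 1 _ hsuffix).2.2.2 b (hmem b (by simp))
        (hG.mem_iff_leftDvd.1 hbS).2
        ⟨t.prod, list_prod_mem fun x hx => hmem x (by simp [hx]), by simp⟩
      rw [hG.noetherian.eq_one_of_mul_eq_one (hmem b (by simp)) hc hbc.symm] at hsuffix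
      exact ih ((List.suffix_cons _ _).trans hsuffix)
  intro h1
  obtain ⟨r, t, hrt⟩ := List.append_of_mem h1
  exact not_suffix t ⟨r, hrt.symm⟩

lemma isNormalList (hG : IsQuasiGarsideSystem S Δ) : IsNormalList S Δ s := by
  refine ⟨fun x hx => mem_diff_pair_iff.2 ⟨hs.simple x hx, fun h => hs.one_notMem hG (h ▸ hx),
    fun h => hs.delta_notMem hG (h ▸ hx)⟩, ?_⟩
  rw [List.isChain_iff_forall_rel_of_append_cons_cons]
  rintro a b r t rfl c hc ⟨d, hd, rfl⟩ hac
  have htP : t.prod ∈ posMonoid S :=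
    list_prod_mem fun x hx => mem_posMonoid (hs.simple x (by simp [hx]))
  obtain ⟨e, he, hace⟩ := (hs.greedy a (c * d :: t) ⟨r, rfl⟩).2.2.2 (a * c) (mem_posMonoid hac)
    (hG.mem_iff_leftDvd.1 hac).2
    ⟨d * t.prod, mul_mem hd htP, by simp only [List.prod_cons, mul_assoc]⟩
  exact hG.noetherian.eq_one_of_mul_eq_one hc he (mul_eq_left.1 (by rw [← mul_assoc, ← hace]))

end IsLeftNormalForm

end LeftNormalForm

section Spindle

variable (hG : IsQuasiGarsideSystem S Δ) (hS : IsSpindleType S)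
include hG hS

/-- Write `Δ = m * e`, `m = a * x = b * y`. The right gcd of the simple elements `x * e` and
`y * e` is a multiple of `e ≠ 1`, so it is one of the two. -/
lemma leftDvd_total_of_leftDvd {a b m : G} (ha : a ∈ posMonoid S) (hb : b ∈ posMonoid S)
    (hm : m ∈ S) (hmΔ : m ≠ Δ) (ham : LeftDvd (posMonoid S) a m)
    (hbm : LeftDvd (posMonoid S) b m) :
    LeftDvd (posMonoid S) a b ∨ LeftDvd (posMonoid S) b a := by
  obtain ⟨e, he, hΔ⟩ := (hG.mem_iff_leftDvd.1 hm).2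
  obtain ⟨x, hx, rfl⟩ := ham
  obtain ⟨y, hy, hby⟩ := hbm
  have hxS : x * e ∈ S :=
    hG.mem_iff_rightDvd.2 ⟨mul_mem hx he, a, ha, by rw [hΔ, mul_assoc]⟩
  have hyS : y * e ∈ S :=
    hG.mem_iff_rightDvd.2 ⟨mul_mem hy he, b, hb, by rw [hΔ, hby, mul_assoc]⟩
  obtain ⟨-, d, hd, -, ⟨f, hf, hxd⟩, ⟨g, hg, hyd⟩, hmax⟩ := hS _ hxS _ hyS
  rcases hd with rfl | rfl | rfl
  · refine .inr ⟨g, hg, mul_right_cancel (b := x * e) ?_⟩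
    rw [mul_assoc b, ← hyd, ← mul_assoc, ← mul_assoc, hby]
  · refine .inl ⟨f, hf, mul_right_cancel (b := y * e) ?_⟩
    rw [mul_assoc a, ← hxd, ← mul_assoc, ← mul_assoc, hby]
  · obtain ⟨c, hc, hce⟩ := hmax e he ⟨x, hx, rfl⟩ ⟨y, hy, rfl⟩
    obtain rfl := hG.noetherian.eq_one_of_mul_eq_one hc he hce.symm
    rw [one_mul] at hce
    exact absurd (by rw [hΔ, ← hce, mul_one]) hmΔ

lemma Greedy.mul_right {x a u : G} (hxa : Greedy S x a) (hx : x ∈ S) (ha : a ∈ S) (ha1 : a ≠ 1)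
    (hu : u ∈ posMonoid S) (hau : a * u ∈ S) (hauΔ : a * u ≠ Δ) : Greedy S x (a * u) := by
  have haP := mem_posMonoid ha
  intro c hc hcau hxc
  rcases leftDvd_total_of_leftDvd hG hS hc haP hau hauΔ hcau ⟨u, hu, rfl⟩ with hca | ⟨d, hd, rfl⟩
  · exact hxa c hc hca hxc
  · have hxaS : x * a ∈ S :=
      hG.mem_of_leftDvd (mul_mem (mem_posMonoid hx) haP) hxc ⟨d, hd, by rw [mul_assoc]⟩
    exact absurd (hxa a haP ⟨1, one_mem _, (mul_one a).symm⟩ hxaS) ha1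

lemma mul_mem_or_eq_delta_mul_or_greedy {a u : G} (ha : a ∈ S) (hu : u ∈ S \ {1, Δ}) :
    a * u ∈ S ∨ (∃ v ∈ S \ {1, Δ}, a * u = Δ * v) ∨ Greedy S a u := by
  obtain ⟨huS, -, huΔ⟩ := mem_diff_pair_iff.1 hu
  have haS := hG.inv_mul_delta_mem ha
  obtain ⟨⟨d, hd, -, ⟨e, he, hda⟩, ⟨v, hv, hdu⟩, hmax⟩, -⟩ := hS _ haS _ huS
  rcases hd with rfl | rfl | rfl
  · have hauv : a * u = Δ * v := by
      rw [hdu]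
      group
    rcases eq_or_ne v 1 with rfl | hv1
    · rw [hauv, mul_one]
      exact .inl hG.delta_mem
    have hvS : v ∈ S := hG.mem_of_rightDvd hv huS ⟨_, mem_posMonoid haS, hdu⟩
    refine .inr (.inl ⟨v, mem_diff_pair_iff.2 ⟨hvS, hv1, ?_⟩, hauv⟩)
    rintro rfl
    exact huΔ (hG.eq_delta_of_rightDvd huS ⟨_, mem_posMonoid haS, hdu⟩)
  · exact .inl (hG.mem_iff_leftDvd.2 ⟨mul_mem (mem_posMonoid ha) (mem_posMonoid huS), e, he, by
      rw [mul_assoc, ← hda, mul_inv_cancel_left]⟩)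
  · refine .inr (.inr fun c hc hcu hac => ?_)
    obtain ⟨e, he, hΔ⟩ := (hG.mem_iff_leftDvd.1 hac).2
    obtain ⟨f, hf, hcf⟩ := hmax c hc ⟨e, he, by rw [hΔ]; group⟩ hcu
    exact hG.noetherian.eq_one_of_mul_eq_one hc hf hcf.symm

namespace IsNormalList

lemma replace_last {t : List G} {a u : G} (ht : IsNormalList S Δ (t ++ [a]))
    (hu : u ∈ posMonoid S) (hau : a * u ∈ S) (hauΔ : a * u ≠ Δ) :
    IsNormalList S Δ (t ++ [a * u]) := by
  obtain ⟨ht', ha, hgreedy⟩ := isNormalList_append_singleton.1 ht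
  obtain ⟨haS, ha1, -⟩ := mem_diff_pair_iff.1 ha
  refine isNormalList_append_singleton.2 ⟨ht', mem_diff_pair_iff.2 ⟨hau, ?_, hauΔ⟩, fun x hx => ?_⟩
  · exact fun hau1 => ha1 (hG.noetherian.eq_one_of_mul_eq_one (mem_posMonoid haS) hu hau1)
  · exact (hgreedy x hx).mul_right hG hS (ht'.proper x (List.mem_of_mem_getLast? hx)).1 haS ha1 hu
      hau hauΔ

lemma exists_mul_proper {t : List G} (ht : IsNormalList S Δ t) {u : G} (hu : u ∈ S \ {1, Δ}) :
    ∃ (p : ℤ) (t' : List G), IsNormalList S Δ t' ∧ t.prod * u = Δ ^ p * t'.prod ∧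
      ((p = 0 ∧ t' = t ++ [u]) ∨ t'.length ≤ t.length) := by
  induction t using List.reverseRecOn generalizing u with
  | nil => exact ⟨0, [u], ⟨by simpa using hu, by simp⟩, by simp, by simp⟩
  | append_singleton t a ih =>
    obtain ⟨ht', ha, -⟩ := isNormalList_append_singleton.1 ht
    have move_delta (q : ℤ) (t' : List G) :
        Δ ^ q * t'.prod * Δ = Δ ^ (q + 1) * (t'.map (twist Δ (-1))).prod := by
      rw [prod_map_twist, twist_neg_one]
      group
    rcases mul_mem_or_eq_delta_mul_or_greedy hG hS ha.1 hu with hau | ⟨v, hv, hauv⟩ | hau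
    · rcases eq_or_ne (a * u) Δ with hauΔ | hauΔ
      · refine ⟨1, t.map (twist Δ (-1)), ht'.map_twist hG _, ?_, .inr (by simp)⟩
        simpa [mul_assoc, hauΔ] using move_delta 0 t
      · exact ⟨0, t ++ [a * u], ht.replace_last hG hS (mem_posMonoid hu.1) hau hauΔ,
          by simp [mul_assoc], .inr (by simp)⟩
    · obtain ⟨p, t', hnormal, hprod, hlen⟩ := ih ht' ((hG.twist_mem_proper_iff 1).2 hv)
      refine ⟨p + 1, t'.map (twist Δ (-1)), hnormal.map_twist hG _, ?_, .inr ?_⟩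
      · rw [← move_delta, ← hprod, List.prod_append, List.prod_singleton, mul_assoc, hauv]
        simp [twist_apply, mul_assoc]
      · rcases hlen with ⟨-, rfl⟩ | hlen
        · simp
        · simpa using hlen.trans (Nat.le_succ _)
    · refine ⟨0, t ++ [a] ++ [u], isNormalList_append_singleton.2 ⟨ht, hu, ?_⟩,
        by simp [mul_assoc], .inl ⟨rfl, rfl⟩⟩
      simpa using hau

end IsNormalList

lemma exists_isNormalList {t : List G} (ht : ∀ x ∈ t, x ∈ S \ {1, Δ}) :
    ∃ (p : ℤ) (t' : List G), IsNormalList S Δ t' ∧ t.prod = Δ ^ p * t'.prod ∧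
      ((p = 0 ∧ t' = t) ∨ t'.length < t.length) := by
  induction t using List.reverseRecOn with
  | nil => exact ⟨0, [], isNormalList_nil, by simp, by simp⟩
  | append_singleton t a ih =>
    obtain ⟨p, t', ht', hprod, hlen⟩ := ih fun x hx => ht x (by simp [hx])
    obtain ⟨q, t'', ht'', hprod', hlen'⟩ := ht'.exists_mul_proper hG hS (ht a (by simp))
    refine ⟨p + q, t'', ht'', ?_, ?_⟩
    · rw [List.prod_append, List.prod_singleton, hprod, mul_assoc, hprod', zpow_add, mul_assoc]
    · rw [List.length_append, List.length_singleton]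
      rcases hlen with ⟨rfl, rfl⟩ | hlen <;> rcases hlen' with ⟨rfl, rfl⟩ | hlen'
      · exact .inl ⟨add_zero 0, rfl⟩
      · omega
      · simpa using .inr hlen
      · omega

lemma IsNormalList.eq_of_length_le (hΔ : Δ ≠ 1) {t t' : List G} {p q : ℤ}
    (ht : ∀ x ∈ t, x ∈ S \ {1, Δ}) (ht' : IsNormalList S Δ t')
    (h : Δ ^ q * t.prod = Δ ^ p * t'.prod) (hlen : t.length ≤ t'.length) : q = p ∧ t = t' := by
  obtain ⟨r, t'', ht'', hprod, hlen'⟩ := exists_isNormalList hG hS ht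
  rw [hprod, ← mul_assoc, ← zpow_add] at h
  obtain ⟨rfl, rfl⟩ := ht''.unique hG hΔ ht' h
  rcases hlen' with ⟨rfl, rfl⟩ | hlen'
  · simp
  · omega

end Spindle

end NormalForms

section MinLength

/-- The least length of a word obtained from `Δ ^ p * s₁ * ⋯ * sₗ` by rewriting some of the factors
`sᵢ` as `Δ * (sᵢ⁻¹ * Δ)⁻¹` and collecting the powers of `Δ`, where the lengths of `Δ` and of the
`sᵢ` are `δ` and the entries of the list. -/
def minLength (δ : ℤ) : ℤ → List ℤ → ℤ
  | p, [] => |p| * δ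
  | p, a :: ns => min (a + minLength δ p ns) (δ - a + minLength δ (p + 1) ns)

variable {δ : ℤ}

lemma minLength_append_singleton (p a : ℤ) (ns : List ℤ) :
    minLength δ p (ns ++ [a]) =
      min (minLength δ p ns + a) (minLength δ (p + 1) ns + (δ - a)) := by
  induction ns generalizing p with
  | nil => simp only [List.nil_append, minLength, add_comm]
  | cons b ns ih =>
    simp only [List.cons_append, minLength, ih]
    omega

lemma abs_minLength_add_one_sub_le (hδ : 0 ≤ δ) (p : ℤ) (ns : List ℤ) :
    |minLength δ (p + 1) ns - minLength δ p ns| ≤ δ := by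
  induction ns generalizing p with
  | nil =>
    rw [minLength, minLength, ← sub_mul, abs_mul, abs_of_nonneg hδ]
    refine mul_le_of_le_one_left hδ ((abs_abs_sub_abs_le _ _).trans ?_)
    simp
  | cons a ns ih =>
    have hp := abs_le.1 (ih p)
    have hp1 := abs_le.1 (ih (p + 1))
    simp only [minLength, abs_le]
    omega

lemma abs_minLength_append_one_sub_le (hδ : 0 ≤ δ) (p : ℤ) (ns : List ℤ) :
    |minLength δ p (ns ++ [1]) - minLength δ p ns| ≤ 1 := by
  have hp := abs_le.1 (abs_minLength_add_one_sub_le hδ p ns)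
  rw [minLength_append_singleton, abs_le]
  omega

lemma abs_minLength_append_add_one_sub_le (p a : ℤ) (ns : List ℤ) :
    |minLength δ p (ns ++ [a + 1]) - minLength δ p (ns ++ [a])| ≤ 1 := by
  rw [minLength_append_singleton, minLength_append_singleton, abs_le]
  omega

lemma abs_minLength_add_one_sub_append_le (hδ : 0 ≤ δ) (p : ℤ) (ns : List ℤ) :
    |minLength δ (p + 1) ns - minLength δ p (ns ++ [δ - 1])| ≤ 1 := by
  have hp := abs_le.1 (abs_minLength_add_one_sub_le hδ p ns)
  rw [minLength_append_singleton, abs_le]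
  omega

/-- Lagrangian relaxation: for `0 ≤ M ≤ δ` the slope `2 * M - δ` is a subgradient at `0` of
`p ↦ |p| * δ`, and for a given slope the factors can be minimised separately. -/
lemma lagrangian_le_minLength {M : ℤ} (hM0 : 0 ≤ M) (hMδ : M ≤ δ) (p : ℤ) (ns : List ℤ) :
    (2 * M - δ) * p + (ns.map fun a => min a (2 * M - a)).sum ≤ minLength δ p ns := by
  induction ns generalizing p with
  | nil =>
    rw [List.map_nil, List.sum_nil, add_zero, minLength, mul_comm |p|]
    calc (2 * M - δ) * p ≤ |2 * M - δ| * |p| := (le_abs_self _).trans_eq (abs_mul _ _)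
      _ ≤ δ * |p| := by
        gcongr
        exact abs_le.2 ⟨by omega, by omega⟩
  | cons a ns ih =>
    have hp := ih p
    have hp1 := ih (p + 1)
    rw [mul_add, mul_one] at hp1
    rw [List.map_cons, List.sum_cons, minLength]
    omega

end MinLength

section WordLowerBound

variable {G : Type*} [Group G] {S : Set G} {Δ : G} {ℓ : G → ℤ}

lemma greedy_of_mem_atoms {a x : G} (hx : x ∈ atoms S) (hax : a * x ∉ S) : Greedy S a x := by
  rintro c hc ⟨d, hd, rfl⟩ hac
  rcases hx.2.2 c hc d hd rfl with hc1 | rfl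
  · exact hc1
  · rw [mul_one] at hax
    exact absurd hac hax

variable (hG : IsQuasiGarsideSystem S Δ) (hS : IsSpindleType S) (hℓ : IsLengthFun S ℓ)
include hG

lemma IsLengthFun.map_map_twist (hℓ : IsLengthFun S ℓ) {t : List G} (ht : IsNormalList S Δ t)
    (k : ℤ) : (t.map (twist Δ k)).map ℓ = t.map ℓ := by
  rw [List.map_map]
  exact List.map_congr_left fun a ha => hℓ.map_twist hG (mem_posMonoid (ht.proper a ha).1) k

lemma IsLengthFun.delta_nonneg (hℓ : IsLengthFun S ℓ) : 0 ≤ ℓ Δ := by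
  rcases eq_or_ne Δ 1 with rfl | hΔ
  · exact hℓ.map_one.ge
  · exact (hℓ.pos hG.noetherian hG.delta_mem_pos hΔ).le

include hS

lemma IsNormalList.exists_mul_inv_atom {t : List G} (ht : IsNormalList S Δ t) {x : G}
    (hx : x ∈ atoms S) :
    ∃ (k : ℤ) (t' : List G), IsNormalList S Δ t' ∧ t.prod * x⁻¹ = Δ ^ k * t'.prod := by
  rcases eq_or_ne x Δ with rfl | hxΔ
  · refine ⟨-1, t.map (twist x 1), ht.map_twist hG 1, ?_⟩
    rw [prod_map_twist, twist_apply]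
    group
  · have hx' := mem_diff_pair_iff.2 ⟨mem_of_mem_atoms hx, hx.2.1, hxΔ⟩
    obtain ⟨k, t', ht', hprod, -⟩ :=
      ht.exists_mul_proper hG hS (hG.inv_mul_delta_mem_proper hx')
    refine ⟨k - 1, t'.map (twist Δ 1), ht'.map_twist hG 1, ?_⟩
    rw [prod_map_twist, twist_apply, ← mul_inv_cancel_right (t.prod * x⁻¹) Δ, mul_assoc t.prod,
      hprod]
    group

include hℓ

lemma IsNormalList.exists_mul_atom {t : List G} (ht : IsNormalList S Δ t) {x : G}
    (hx : x ∈ atoms S) :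
    ∃ (k : ℤ) (t' : List G), IsNormalList S Δ t' ∧ t.prod * x = Δ ^ k * t'.prod ∧
      ∀ p, |minLength (ℓ Δ) (p + k) (t'.map ℓ) - minLength (ℓ Δ) p (t.map ℓ)| ≤ 1 := by
  have hδ := hℓ.delta_nonneg hG
  have hℓx := hℓ.atom x hx
  rcases eq_or_ne x Δ with rfl | hxΔ
  · refine ⟨1, t.map (twist x (-1)), ht.map_twist hG _, ?_, fun p => ?_⟩
    · rw [prod_map_twist, twist_neg_one]
      group
    · rw [hℓ.map_map_twist hG ht]
      exact (abs_minLength_add_one_sub_le hδ p _).trans hℓx.le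
  have hx' := mem_diff_pair_iff.2 ⟨mem_of_mem_atoms hx, hx.2.1, hxΔ⟩
  by_cases hgreedy : ∀ a ∈ t.getLast?, Greedy S a x
  · refine ⟨0, t ++ [x], isNormalList_append_singleton.2 ⟨ht, hx', hgreedy⟩, by simp,
      fun p => ?_⟩
    rw [List.map_append, List.map_singleton, hℓx, add_zero]
    exact abs_minLength_append_one_sub_le hδ p _
  obtain ⟨a, hlast, hax⟩ : ∃ a ∈ t.getLast?, a * x ∈ S := by
    by_contra! hcon
    exact hgreedy fun a ha => greedy_of_mem_atoms hx (hcon a ha)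
  obtain ⟨t, rfl⟩ := List.getLast?_eq_some_iff.1 hlast
  obtain ⟨ht', ha, -⟩ := isNormalList_append_singleton.1 ht
  have hℓax : ℓ (a * x) = ℓ a + 1 := by rw [hℓ.map_mul _ (mem_posMonoid ha.1) _ hx.1, hℓx]
  rcases eq_or_ne (a * x) Δ with haxΔ | haxΔ
  · refine ⟨1, t.map (twist Δ (-1)), ht'.map_twist hG _, ?_, fun p => ?_⟩
    · rw [prod_map_twist, twist_neg_one, List.prod_append, List.prod_singleton, mul_assoc, haxΔ]
      group
    · rw [hℓ.map_map_twist hG ht', List.map_append, List.map_singleton,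
        eq_sub_of_add_eq hℓax.symm, haxΔ]
      exact abs_minLength_add_one_sub_append_le hδ p _
  · refine ⟨0, t ++ [a * x], ht.replace_last hG hS hx.1 hax haxΔ, by simp [mul_assoc],
      fun p => ?_⟩
    rw [List.map_append, List.map_append, List.map_singleton, List.map_singleton, hℓax, add_zero]
    exact abs_minLength_append_add_one_sub_le p _ _

lemma exists_isNormalList_minLength_le (hΔ : Δ ≠ 1) {w : Word G} (hw : IsWord (atoms S) w) :
    ∃ (p : ℤ) (t : List G), IsNormalList S Δ t ∧ eval w = Δ ^ p * t.prod ∧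
      minLength (ℓ Δ) p (t.map ℓ) ≤ w.length := by
  induction w using List.reverseRecOn with
  | nil => exact ⟨0, [], isNormalList_nil, by simp, by simp [minLength]⟩
  | append_singleton w y ih =>
    obtain ⟨p, t, ht, heval, hlen⟩ := ih fun z hz => hw z (by simp [hz])
    obtain ⟨x, b⟩ := y
    have hx : x ∈ atoms S := hw (x, b) (by simp)
    rw [List.length_append, List.length_singleton, Nat.cast_add, Nat.cast_one]
    cases b with
    | true =>
      obtain ⟨k, t', ht', hprod, hstep⟩ := ht.exists_mul_atom hG hS hℓ hx
      refine ⟨p + k, t', ht', ?_, by linarith [(abs_le.1 (hstep p)).2]⟩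
      rw [zpow_add, mul_assoc, ← hprod, ← mul_assoc, ← heval]
      simp [eval]
    | false =>
      obtain ⟨k, t', ht', hprod⟩ := ht.exists_mul_inv_atom hG hS hx
      obtain ⟨j, t'', ht'', hprod', hstep⟩ := ht'.exists_mul_atom hG hS hℓ hx
      obtain ⟨hjk, rfl⟩ : k + j = 0 ∧ t'' = t := by
        refine ht''.unique hG hΔ ht ?_
        rw [zpow_add, mul_assoc, ← hprod', ← mul_assoc, ← hprod, inv_mul_cancel_right, zpow_zero,
          one_mul]
      refine ⟨p + k, t', ht', ?_, ?_⟩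
      · rw [zpow_add, mul_assoc, ← hprod, ← mul_assoc, ← heval]
        simp [eval]
      · have hback := (abs_le.1 (hstep (p + k))).1
        rw [add_assoc, hjk, add_zero] at hback
        linarith

lemma IsNormalList.minLength_le_length (hΔ : Δ ≠ 1) {t : List G} (ht : IsNormalList S Δ t) {p : ℤ}
    {w : Word G} (hw : IsWord (atoms S) w) (heval : eval w = Δ ^ p * t.prod) :
    minLength (ℓ Δ) p (t.map ℓ) ≤ w.length := by
  obtain ⟨q, t', ht', heval', hlen⟩ := exists_isNormalList_minLength_le hG hS hℓ hΔ hw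
  obtain ⟨rfl, rfl⟩ := ht.unique hG hΔ ht' (heval.symm.trans heval')
  exact hlen

end WordLowerBound

section Blocks

variable {G : Type*} [Group G] {S : Set G} {Δ : G} {ℓ : G → ℤ}

/-- The word `u` is a factor of a decomposition and represents `Δ ^ k * a` with `a` a proper simple
element, where `k = 0` if `u` is positive and `k = -1` if `u` is negative. -/
inductive IsBlock (S : Set G) (Δ : G) : Word G → ℤ → G → Prop
  | pos {u : Word G} (hu : IsPosBlock S Δ u) : IsBlock S Δ u 0 (eval u)
  | neg {u : Word G} (hu : IsNegBlock S Δ u) : IsBlock S Δ u (-1) (Δ * eval u)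

/-- The factors in the list `L` represent in turn the elements `Δ ^ kᵢ * aᵢ` of `IsBlock`, and
moving all powers of `Δ` to the front turns their product into `Δ ^ n * t.prod`. -/
inductive Straightens (S : Set G) (Δ : G) : List (Word G) → ℤ → List G → Prop
  | nil : Straightens S Δ [] 0 []
  | cons {u : Word G} {k n : ℤ} {a : G} {L : List (Word G)} {t : List G} (hu : IsBlock S Δ u k a)
      (hL : Straightens S Δ L n t) :
      Straightens S Δ (u :: L) (k + n) (twist Δ (-n) a :: t)

variable {u u' v v' : Word G} {k k' n n' : ℤ} {a : G} {L L' : List (Word G)} {t : List G}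

lemma IsPosBlock.tauWord (hG : IsQuasiGarsideSystem S Δ) (hu : IsPosBlock S Δ u) :
    IsPosBlock S Δ (tauWord Δ u) := by
  refine ⟨fun y hy => ?_, ?_⟩
  · obtain ⟨z, hz, rfl⟩ := List.mem_map.1 hy
    obtain ⟨hatom, hsign⟩ := hu.1 z hz
    exact ⟨twist_neg_one z.1 ▸ hG.twist_mem_atoms hatom (-1), hsign⟩
  · rw [eval_tauWord]
    exact (hG.twist_mem_proper_iff _).2 hu.2

lemma IsNegBlock.tauWord (hG : IsQuasiGarsideSystem S Δ) (hu : IsNegBlock S Δ u) :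
    IsNegBlock S Δ (tauWord Δ u) := by
  refine ⟨fun y hy => ?_, ?_⟩
  · obtain ⟨z, hz, rfl⟩ := List.mem_map.1 hy
    obtain ⟨hatom, hsign⟩ := hu.1 z hz
    exact ⟨twist_neg_one z.1 ▸ hG.twist_mem_atoms hatom (-1), hsign⟩
  · rw [eval_tauWord, ← map_inv]
    exact (hG.twist_mem_proper_iff _).2 hu.2

namespace IsBlock

lemma eval_eq (hu : IsBlock S Δ u k a) : eval u = Δ ^ k * a := by
  cases hu <;> simp

lemma isWord (hu : IsBlock S Δ u k a) : IsWord (atoms S) u := by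
  rcases hu with hu | hu
  exacts [hu.1.isWord, hu.1.isWord]

lemma proper (hG : IsQuasiGarsideSystem S Δ) (hu : IsBlock S Δ u k a) : a ∈ S \ {1, Δ} := by
  rcases hu with hu | hu
  · exact hu.2
  · simpa using hG.delta_mul_inv_mem_proper hu.2

lemma tauWord (hG : IsQuasiGarsideSystem S Δ) (hu : IsBlock S Δ u k a) :
    IsBlock S Δ (tauWord Δ u) k (twist Δ (-1) a) := by
  rcases hu with hu | hu
  · rw [← eval_tauWord]
    exact .pos (hu.tauWord hG)
  · rw [map_mul, twist_delta, ← eval_tauWord]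
    exact .neg (hu.tauWord hG)

lemma ne_nil (hu : IsBlock S Δ u k a) : u ≠ [] := by
  rintro rfl
  rcases hu with hu | hu
  · exact (mem_diff_pair_iff.1 hu.2).2.1 rfl
  · exact (mem_diff_pair_iff.1 hu.2).2.1 inv_one

lemma exponent_eq_of_mem {a' : G} {y : G × Bool} (hu : IsBlock S Δ u k a)
    (hu' : IsBlock S Δ u' k' a') (hy : y ∈ u) (hy' : y ∈ u') : k = k' := by
  rcases hu with hu | hu <;> rcases hu' with hu' | hu'
  · rfl
  · exact absurd (hu.1 y hy).2 (by simp [(hu'.1 y hy').2])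
  · exact absurd (hu.1 y hy).2 (by simp [(hu'.1 y hy').2])
  · rfl

lemma length_eq (hG : IsQuasiGarsideSystem S Δ) (hℓ : IsLengthFun S ℓ) (hu : IsBlock S Δ u k a) :
    (u.length : ℤ) = if k = 0 then ℓ a else ℓ Δ - ℓ a := by
  rcases hu with hu | hu
  · rw [if_pos rfl, hℓ.map_eval_pos hu.1]
  · have hmap := hℓ.map_delta_mul_inv hG hu.2.1
    rw [inv_inv, hℓ.map_inv_eval_neg hu.1] at hmap
    rw [if_neg (by decide), hmap, sub_sub_cancel]

lemma eq_of_append_eq (hG : IsQuasiGarsideSystem S Δ) (hℓ : IsLengthFun S ℓ)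
    (hu : IsBlock S Δ u k a) (hu' : IsBlock S Δ u' k' a) (h : v ++ u = v' ++ u') :
    k = k' ∧ u = u' := by
  have hk : k = k' := by
    rcases List.suffix_or_suffix_of_suffix ⟨v, h⟩ ⟨v', rfl⟩ with hsuffix | hsuffix
    · obtain ⟨y, hy⟩ := List.exists_mem_of_ne_nil u hu.ne_nil
      exact hu.exponent_eq_of_mem hu' hy (hsuffix.subset hy)
    · obtain ⟨y, hy⟩ := List.exists_mem_of_ne_nil u' hu'.ne_nil
      exact hu.exponent_eq_of_mem hu' (hsuffix.subset hy) hy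
  have hlen := hu'.length_eq hG hℓ
  rw [← hk, ← hu.length_eq hG hℓ] at hlen
  exact ⟨hk, (List.append_inj' h (by exact_mod_cast hlen.symm)).2⟩

end IsBlock

lemma IsPosBlock.not_isNegBlock (hu : IsPosBlock S Δ u) : ¬ IsNegBlock S Δ u := by
  intro hneg
  obtain ⟨y, hy⟩ := List.exists_mem_of_ne_nil u (IsBlock.pos hu).ne_nil
  exact absurd ((IsBlock.pos hu).exponent_eq_of_mem (.neg hneg) hy hy) (by decide)

lemma exists_straightens (hL : ∀ u ∈ L, IsPosBlock S Δ u ∨ IsNegBlock S Δ u) :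
    ∃ n t, Straightens S Δ L n t := by
  induction L with
  | nil => exact ⟨0, [], .nil⟩
  | cons u L ih =>
    obtain ⟨n, t, h⟩ := ih fun v hv => hL v (List.mem_cons_of_mem u hv)
    rcases hL u List.mem_cons_self with hu | hu
    exacts [⟨_, _, .cons (.pos hu) h⟩, ⟨_, _, .cons (.neg hu) h⟩]

lemma straightens_of_forall_isPosBlock (hL : ∀ u ∈ L, IsPosBlock S Δ u) :
    Straightens S Δ L 0 (L.map eval) := by
  induction L with
  | nil => exact .nil
  | cons u L ih =>
    simpa using Straightens.cons (.pos (hL u List.mem_cons_self))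
      (ih fun v hv => hL v (List.mem_cons_of_mem u hv))

namespace Straightens

lemma exists_of_cons (h : Straightens S Δ (u :: L) n t) :
    ∃ k m a s, IsBlock S Δ u k a ∧ Straightens S Δ L m s ∧ n = k + m ∧
      t = twist Δ (-m) a :: s := by
  rcases h with _ | ⟨hu, hL⟩
  exact ⟨_, _, _, _, hu, hL, rfl, rfl⟩

lemma length_eq (h : Straightens S Δ L n t) : t.length = L.length := by
  induction h with
  | nil => rfl
  | cons _ _ ih => rw [List.length_cons, List.length_cons, ih]

lemma forall_isWord (h : Straightens S Δ L n t) : ∀ u ∈ L, IsWord (atoms S) u := by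
  induction h with
  | nil => simp
  | cons hu _ ih => exact List.forall_mem_cons.2 ⟨hu.isWord, ih⟩

lemma eval_flatten (h : Straightens S Δ L n t) : eval L.flatten = Δ ^ n * t.prod := by
  induction h with
  | nil => simp
  | cons hu _ ih =>
    rw [List.flatten_cons, eval_append, ih, hu.eval_eq, List.prod_cons, twist_apply]
    group

lemma proper (hG : IsQuasiGarsideSystem S Δ) (h : Straightens S Δ L n t) :
    ∀ x ∈ t, x ∈ S \ {1, Δ} := by
  induction h with
  | nil => simp
  | cons hu _ ih =>
    exact List.forall_mem_cons.2 ⟨(hG.twist_mem_proper_iff _).2 (hu.proper hG), ih⟩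

lemma unique (hG : IsQuasiGarsideSystem S Δ) (hℓ : IsLengthFun S ℓ) (h : Straightens S Δ L n t)
    (h' : Straightens S Δ L' n' t) (heq : v ++ L.flatten = v' ++ L'.flatten) :
    n = n' ∧ L = L' := by
  induction h generalizing L' n' v v' with
  | nil =>
    cases h'
    exact ⟨rfl, rfl⟩
  | @cons u k n a L t hu _ ih =>
    generalize hs : twist Δ (-n) a :: t = s at h'
    cases h' with
    | nil => cases hs
    | @cons u' k' m a' L' t' hu' hL' =>
      obtain ⟨ha, rfl⟩ := List.cons.inj hs
      rw [List.flatten_cons, List.flatten_cons, ← List.append_assoc, ← List.append_assoc] at heq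
      obtain ⟨rfl, rfl⟩ := ih hL' heq
      obtain rfl := (twist Δ (-n)).injective ha
      obtain ⟨rfl, rfl⟩ := hu.eq_of_append_eq hG hℓ hu' (List.append_cancel_right heq)
      exact ⟨rfl, rfl⟩

lemma replace_pos (hG : IsQuasiGarsideSystem S Δ) (hu : IsPosBlock S Δ u)
    (hu' : IsNegBlock S Δ u') (huu' : Δ * eval u' = eval u) {L₁ L₂ : List (Word G)}
    (h : Straightens S Δ (L₁ ++ u :: L₂) n t) :
    Straightens S Δ (L₁.map (tauWord Δ) ++ u' :: L₂) (n - 1) t := by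
  induction L₁ generalizing n t with
  | nil =>
    obtain ⟨k, m, a, s, hblock, hL₂, rfl, rfl⟩ := h.exists_of_cons
    cases hblock with
    | pos _ =>
      rw [← huu', zero_add, sub_eq_neg_add]
      exact .cons (.neg hu') hL₂
    | neg hneg => exact absurd hneg hu.not_isNegBlock
  | cons x L₁ ih =>
    obtain ⟨k, m, a, s, hx, hL, rfl, rfl⟩ := h.exists_of_cons
    have hcons := Straightens.cons (hx.tauWord hG) (ih hL)
    rwa [twist_twist, ← add_sub_assoc, neg_sub', sub_neg_eq_add, add_neg_cancel_right] at hcons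

end Straightens

end Blocks

section Reduction

variable {G : Type*} [Group G] {S : Set G} {Δ : G} {ℓ : G → ℤ}

/-- The factors in `L` that are positive are the short ones: with `d` the length of `Δ`, the
positive factors have length at most `M`, and the simple elements to which the negative factors are
complementary have length at least `M`. -/
def IsThreshold (S : Set G) (Δ : G) (d M : ℕ) (L : List (Word G)) : Prop :=
  ∀ u ∈ L, (IsPosBlock S Δ u ∧ u.length ≤ M) ∨ (IsNegBlock S Δ u ∧ u.length + M ≤ d)

/-- The invariant of the reduction: `w ≡ D ^ r w₁ ⋯ wₛ` comes from a normal form in which the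
longest factors have been made negative. -/
structure IsThresholdDecomposition (S : Set G) (Δ : G) (D w : Word G) (r : ℤ)
    (L : List (Word G)) : Prop where
  eq_append : w = wordPow D r ++ L.flatten
  straightens : ∃ n t, Straightens S Δ L n t ∧ IsNormalList S Δ t
  threshold : ∃ M ≤ D.length, IsThreshold S Δ D.length M L ∧ (r ≤ 0 ∨ M = D.length)

variable {D w w' u u' : Word G} {r r' n : ℤ} {L L' L₁ L₂ : List (Word G)} {t : List G} {M : ℕ}

lemma IsThreshold.isPosBlock_or_isNegBlock {d : ℕ} (hL : IsThreshold S Δ d M L) :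
    ∀ u ∈ L, IsPosBlock S Δ u ∨ IsNegBlock S Δ u :=
  fun u hu => (hL u hu).imp And.left And.left

lemma IsMinNegComplement.isNegBlock (hG : IsQuasiGarsideSystem S Δ) (hu : IsPosBlock S Δ u)
    (h : IsMinNegComplement S Δ u u') : IsNegBlock S Δ u' := by
  refine ⟨h.1, ?_⟩
  rw [show (eval u')⁻¹ = (eval u)⁻¹ * Δ by rw [← h.2.1]; group]
  exact hG.inv_mul_delta_mem_proper hu.2

lemma IsLengthFun.length_add_length_of_delta_mul_eq (hℓ : IsLengthFun S ℓ)
    (hG : IsQuasiGarsideSystem S Δ) (hu : IsPosBlock S Δ u) (hu' : IsNegWord (atoms S) u')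
    (h : Δ * eval u' = eval u) : (u.length + u'.length : ℤ) = ℓ Δ := by
  have hmap := hℓ.map_inv_mul_delta hG hu.2.1
  rw [show (eval u)⁻¹ * Δ = (eval u')⁻¹ by rw [← h]; group, hℓ.map_inv_eval_neg hu',
    hℓ.map_eval_pos hu.1] at hmap
  omega

lemma exists_isMinNegComplement (hG : IsQuasiGarsideSystem S Δ) (hℓ : IsLengthFun S ℓ)
    (hu : IsPosBlock S Δ u) : ∃ u', IsMinNegComplement S Δ u u' := by
  obtain ⟨v, hv, heval⟩ := exists_isPosWord_eval_eq hG.noetherian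
    (mem_posMonoid (hG.inv_mul_delta_mem hu.2.1))
  have hΔv : Δ * eval (FreeGroup.invRev v) = eval u := by
    rw [eval_invRev, heval]
    group
  refine ⟨FreeGroup.invRev v, hv.isNegWord_invRev, hΔv, fun v' hv' hΔv' => ?_⟩
  have hlen := hℓ.length_add_length_of_delta_mul_eq hG hu hv.isNegWord_invRev hΔv
  have hlen' := hℓ.length_add_length_of_delta_mul_eq hG hu hv' hΔv'
  omega

lemma Straightens.sub_le_sum (hG : IsQuasiGarsideSystem S Δ) (hℓ : IsLengthFun S ℓ) {d : ℕ}
    (hd : (d : ℤ) = ℓ Δ) (h : Straightens S Δ L n t) (hM : IsThreshold S Δ d M L) :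
    L.flatten.length - (2 * M - ℓ Δ) * n ≤
      ((t.map ℓ).map fun a : ℤ => min a (2 * M - a)).sum := by
  induction h with
  | nil => simp
  | @cons u k n a L t hu _ ih =>
    obtain ⟨hMu, hML⟩ := List.forall_mem_cons.1 hM
    have hL := ih hML
    have ha : ℓ (twist Δ (-n) a) = ℓ a := hℓ.map_twist hG (mem_posMonoid (hu.proper hG).1) _
    have hlen := hu.length_eq hG hℓ
    simp only [List.map_cons, List.sum_cons, List.flatten_cons, List.length_append, ha, mul_add]
    push_cast
    cases hu with
    | pos hu =>
      have := (hMu.resolve_right fun h => hu.not_isNegBlock h.1).2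
      rw [if_pos rfl] at hlen
      omega
    | neg hu =>
      have := (hMu.resolve_left fun h => h.1.not_isNegBlock hu).2
      rw [if_neg (by decide)] at hlen
      omega

namespace IsThresholdDecomposition

variable (hG : IsQuasiGarsideSystem S Δ) (hS : IsSpindleType S) (hℓ : IsLengthFun S ℓ)

lemma isWord (h : IsThresholdDecomposition S Δ D w r L) (hD : IsPosWord (atoms S) D) :
    IsWord (atoms S) w := by
  obtain ⟨n, t, hL, -⟩ := h.straightens
  rw [h.eq_append, isWord_append]
  refine ⟨hD.isWord_wordPow r, fun y hy => ?_⟩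
  obtain ⟨u, hu, hyu⟩ := List.mem_flatten.1 hy
  exact hL.forall_isWord u hu y hyu

/-- At the end of the reduction the Lagrange multiplier `2 * N - δ` is a subgradient of
`p ↦ |p| * δ` at the exponent reached, with `N = 0` in case all factors are negative. -/
lemma exists_isThreshold_abs_mul_eq (h : IsThresholdDecomposition S Δ D w r L)
    (hfinal : 0 ≤ r ∨ ∀ u ∈ L, IsNegBlock S Δ u) :
    ∃ N ≤ D.length, IsThreshold S Δ D.length N L ∧
      |r| * D.length = (2 * N - D.length) * r := by
  obtain ⟨-, -, M, hMD, hM, hr⟩ := h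
  rcases le_or_gt r 0 with hr0 | hr0
  · rcases hfinal with hr0' | hneg
    · obtain rfl := le_antisymm hr0 hr0'
      exact ⟨M, hMD, hM, by simp⟩
    · refine ⟨0, zero_le, fun u hu => .inr ⟨hneg u hu, ?_⟩, ?_⟩
      · rcases hM u hu with hu | hu <;> omega
      · rw [abs_of_nonpos hr0]
        push_cast
        ring
  · obtain rfl : M = D.length := hr.resolve_left (by omega)
    refine ⟨D.length, le_rfl, hM, ?_⟩
    rw [abs_of_pos hr0]
    ring

include hG hS hℓ

lemma isMinDecomposition_iff (h : IsThresholdDecomposition S Δ D w r L) (hΔ : Δ ≠ 1)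
    (hDΔ : eval D = Δ) : IsMinDecomposition S Δ D w r' L' ↔ r' = r ∧ L' = L := by
  obtain ⟨rfl, ⟨n, t, hL, ht⟩, M, -, hM, -⟩ := h
  have eq_of_length_le {q : ℤ} {K : List (Word G)}
      (hK : IsDecomposition S Δ D (wordPow D r ++ L.flatten) q K) (hlen : K.length ≤ L.length) :
      q = r ∧ K = L := by
    obtain ⟨heq, hblocks⟩ := hK
    obtain ⟨m, s, hs⟩ := exists_straightens hblocks
    have heval := congrArg eval heq.symm
    rw [eval_append, eval_append, eval_wordPow, eval_wordPow, hDΔ, hs.eval_flatten,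
      hL.eval_flatten, ← mul_assoc, ← mul_assoc, ← zpow_add, ← zpow_add] at heval
    obtain ⟨hexp, rfl⟩ := ht.eq_of_length_le hG hS hΔ (hs.proper hG) heval
      (by rwa [hs.length_eq, hL.length_eq])
    obtain ⟨rfl, rfl⟩ := hs.unique hG hℓ hL heq.symm
    exact ⟨by omega, rfl⟩
  have hdecomp : IsDecomposition S Δ D (wordPow D r ++ L.flatten) r L :=
    ⟨rfl, hM.isPosBlock_or_isNegBlock⟩
  refine ⟨fun h => eq_of_length_le h.1 (h.2 r L hdecomp), ?_⟩
  rintro ⟨rfl, rfl⟩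
  refine ⟨hdecomp, fun q K hK => ?_⟩
  by_contra! hlt
  rw [(eq_of_length_le hK hlt.le).2] at hlt
  exact lt_irrefl _ hlt

omit hS in
lemma replace_pos (h : IsThresholdDecomposition S Δ D w r (L₁ ++ u :: L₂)) (hDΔ : eval D = Δ)
    (hDpos : IsPosWord (atoms S) D) (hr : r < 0) (hu : IsPosBlock S Δ u)
    (hmax : ∀ x ∈ L₁ ++ u :: L₂, IsPosBlock S Δ x → x.length ≤ u.length)
    (hu' : IsMinNegComplement S Δ u u')
    (hw' : w' = wordPow D (r + 1) ++ (L₁.map (tauWord Δ)).flatten ++ u' ++ L₂.flatten) :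
    IsThresholdDecomposition S Δ D w' (r + 1) (L₁.map (tauWord Δ) ++ u' :: L₂) ∧
      eval w' = eval w := by
  obtain ⟨rfl, ⟨n, t, hL, ht⟩, M, -, hM, -⟩ := h
  have hneg := hu'.isNegBlock hG hu
  have hlen : u.length + u'.length = D.length := by
    have := hℓ.length_add_length_of_delta_mul_eq hG hu hu'.1 hu'.2.1
    rw [← hDΔ, hℓ.map_eval_pos hDpos] at this
    exact_mod_cast this
  have huM : u.length ≤ M :=
    ((hM u (by simp)).resolve_right fun h => hu.not_isNegBlock h.1).2
  have hthreshold : ∀ x ∈ L₁ ++ u :: L₂, (IsPosBlock S Δ x ∧ x.length ≤ u.length) ∨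
      (IsNegBlock S Δ x ∧ x.length + u.length ≤ D.length) := fun x hx =>
    (hM x hx).imp (fun h => ⟨h.1, hmax x hx h.1⟩) fun h => ⟨h.1, by omega⟩
  have hstraight := hL.replace_pos hG hu hneg hu'.2.1
  refine ⟨⟨by simp [hw'], ⟨_, _, hstraight, ht⟩, u.length, by omega, fun x hx => ?_, ?_⟩, ?_⟩
  · simp only [List.mem_append, List.mem_cons, List.mem_map] at hx
    rcases hx with ⟨z, hz, rfl⟩ | rfl | hx
    · rw [tauWord, List.length_map]
      exact (hthreshold z (by simp [hz])).imp (fun h => ⟨h.1.tauWord hG, h.2⟩)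
        fun h => ⟨h.1.tauWord hG, h.2⟩
    · exact .inr ⟨hneg, by omega⟩
    · exact hthreshold x (by simp [hx])
  · omega
  · have hflat : w' = wordPow D (r + 1) ++ (L₁.map (tauWord Δ) ++ u' :: L₂).flatten := by
      simp [hw']
    rw [hflat, eval_append, eval_append, eval_wordPow, eval_wordPow, hDΔ, hstraight.eval_flatten,
      hL.eval_flatten]
    group

lemma length_le (h : IsThresholdDecomposition S Δ D w r L) (hΔ : Δ ≠ 1) (hDΔ : eval D = Δ)
    (hD : IsPosWord (atoms S) D) (hfinal : 0 ≤ r ∨ ∀ u ∈ L, IsNegBlock S Δ u)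
    (hw' : IsWord (atoms S) w') (heval : eval w' = eval w) : w.length ≤ w'.length := by
  obtain ⟨N, hND, hN, hslope⟩ := h.exists_isThreshold_abs_mul_eq hfinal
  obtain ⟨rfl, ⟨n, t, hL, ht⟩, -⟩ := h
  have hd : (D.length : ℤ) = ℓ Δ := by rw [← hDΔ, hℓ.map_eval_pos hD]
  have hnormal : eval w' = Δ ^ (r + n) * t.prod := by
    rw [heval, eval_append, eval_wordPow, hDΔ, hL.eval_flatten, zpow_add, mul_assoc]
  have hsum := hL.sub_le_sum hG hℓ hd hN
  have hlagrange := lagrangian_le_minLength (δ := ℓ Δ) (M := N) (by omega) (by omega) (r + n)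
    (t.map ℓ)
  have hmin := ht.minLength_le_length hG hS hℓ hΔ hw' hnormal
  have hlen : ((wordPow D r ++ L.flatten).length : ℤ) = |r| * ℓ Δ + L.flatten.length := by
    rw [List.length_append, length_wordPow, Nat.cast_add, Nat.cast_mul, Int.natCast_natAbs, hd]
  rw [hd] at hslope
  rw [mul_add] at hlagrange
  exact_mod_cast (by linarith : ((wordPow D r ++ L.flatten).length : ℤ) ≤ w'.length)

end IsThresholdDecomposition

end Reduction

lemma iterRel_of_forall_step {α : Type*} {R : α → α → Prop} {P : ℕ → α → Prop}
    (hstep : ∀ n a, P (n + 1) a → (∃ b, R a b) ∧ ∀ b, R a b → P n b) {n : ℕ} {a : α} (ha : P n a) :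
    (∃ b, iterRel R n a b) ∧ ∀ b, iterRel R n a b → P 0 b := by
  induction n generalizing a with
  | zero =>
    refine ⟨⟨a, rfl⟩, ?_⟩
    rintro b rfl
    exact ha
  | succ n ih =>
    obtain ⟨⟨c, hac⟩, hP⟩ := hstep n a ha
    obtain ⟨b, hcb⟩ := (ih (hP c hac)).1
    exact ⟨⟨b, c, hac, hcb⟩, fun b ⟨c, hac, hcb⟩ => (ih (hP c hac)).2 b hcb⟩

section ReductionSteps

variable {G : Type*} [Group G] {S : Set G} {Δ : G} {ℓ : G → ℤ} {D w v : Word G} {r : ℤ}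
  {L : List (Word G)}
  (hG : IsQuasiGarsideSystem S Δ) (hS : IsSpindleType S) (hℓ : IsLengthFun S ℓ)

include hG hℓ in
lemma IsNormalList.isThresholdDecomposition (hL : IsNormalList S Δ (L.map eval))
    (hpos : ∀ u ∈ L, IsPosWord (atoms S) u) (hD : IsPosWord (atoms S) D) (hDΔ : eval D = Δ) :
    IsThresholdDecomposition S Δ D (wordPow D r ++ L.flatten) r L := by
  have hblocks : ∀ u ∈ L, IsPosBlock S Δ u := fun u hu =>
    ⟨hpos u hu, hL.proper _ (List.mem_map_of_mem hu)⟩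
  refine ⟨rfl, ⟨0, _, straightens_of_forall_isPosBlock hblocks, hL⟩, D.length, le_rfl,
    fun u hu => .inl ⟨hblocks u hu, ?_⟩, .inr rfl⟩
  obtain ⟨u', hu'⟩ := exists_isMinNegComplement hG hℓ (hblocks u hu)
  have hlen := hℓ.length_add_length_of_delta_mul_eq hG (hblocks u hu) hu'.1 hu'.2.1
  rw [← hDΔ, hℓ.map_eval_pos hD] at hlen
  omega

namespace IsThresholdDecomposition

include hG hS hℓ

lemma exists_redStep (h : IsThresholdDecomposition S Δ D w r L) (hΔ : Δ ≠ 1)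
    (hDΔ : eval D = Δ) : ∃ v, RedStep S Δ D w v := by
  classical
  have hmin := (h.isMinDecomposition_iff hG hS hℓ hΔ hDΔ).2 ⟨rfl, rfl⟩
  by_cases hfinal : 0 ≤ r ∨ ∀ u ∈ L, IsNegBlock S Δ u
  · exact ⟨w, r, L, hmin, .inl ⟨hfinal, rfl⟩⟩
  push Not at hfinal
  obtain ⟨hr, u₀, hu₀, hneg⟩ := hfinal
  have hu₀pos := (hmin.1.2 u₀ hu₀).resolve_right hneg
  obtain ⟨u, hu, hmax⟩ := (L.toFinset.filter (IsPosBlock S Δ)).exists_max_image List.length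
    ⟨u₀, by simp [hu₀, hu₀pos]⟩
  simp only [Finset.mem_filter, List.mem_toFinset, and_imp] at hu hmax
  obtain ⟨u', hu'⟩ := exists_isMinNegComplement hG hℓ hu.2
  obtain ⟨L₁, L₂, rfl⟩ := List.append_of_mem hu.1
  exact ⟨_, r, _, hmin, .inr ⟨hr, L₁, u, L₂, u', rfl, hu.2, hmax, hu', rfl⟩⟩

lemma of_redStep (h : IsThresholdDecomposition S Δ D w r L) (hΔ : Δ ≠ 1) (hDΔ : eval D = Δ)
    (hD : IsPosWord (atoms S) D) (hwv : RedStep S Δ D w v) :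
    ((0 ≤ r ∨ ∀ u ∈ L, IsNegBlock S Δ u) ∧ v = w) ∨
      (¬ (0 ≤ r ∨ ∀ u ∈ L, IsNegBlock S Δ u) ∧
        (∃ L', IsThresholdDecomposition S Δ D v (r + 1) L') ∧ eval v = eval w) := by
  obtain ⟨r', L', hmin, hstep⟩ := hwv
  obtain ⟨rfl, rfl⟩ := (h.isMinDecomposition_iff hG hS hℓ hΔ hDΔ).1 hmin
  refine hstep.imp_right ?_
  rintro ⟨hr, L₁, u, L₂, u', rfl, hu, hmax, hu', hv⟩
  have hnotfinal : ¬ (0 ≤ r' ∨ ∀ x ∈ L₁ ++ u :: L₂, IsNegBlock S Δ x) := fun hfinal =>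
    hfinal.elim hr.not_ge fun hneg => hu.not_isNegBlock (hneg u (by simp))
  exact ⟨hnotfinal, (h.replace_pos hG hℓ hDΔ hD hr hu hmax hu' hv).imp_left fun h => ⟨_, h⟩⟩

lemma iterRel_redStep (h : IsThresholdDecomposition S Δ D w r L) (hΔ : Δ ≠ 1) (hDΔ : eval D = Δ)
    (hD : IsPosWord (atoms S) D) {n : ℕ} (hr : -r ≤ n) :
    (∃ v, iterRel (RedStep S Δ D) n w v) ∧ ∀ v, iterRel (RedStep S Δ D) n w v →
      ∃ r' L', IsThresholdDecomposition S Δ D v r' L' ∧ (0 ≤ r' ∨ ∀ u ∈ L', IsNegBlock S Δ u) ∧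
        eval v = eval w := by
  let P (n : ℕ) (v : Word G) : Prop := ∃ r' L', IsThresholdDecomposition S Δ D v r' L' ∧
    ((0 ≤ r' ∨ ∀ u ∈ L', IsNegBlock S Δ u) ∨ -r' ≤ n) ∧ eval v = eval w
  have hstep : ∀ n v, P (n + 1) v →
      (∃ v', RedStep S Δ D v v') ∧ ∀ v', RedStep S Δ D v v' → P n v' := by
    rintro n v ⟨r', L', hv, hr', heval⟩
    refine ⟨hv.exists_redStep hG hS hℓ hΔ hDΔ, fun v' hvv' => ?_⟩
    rcases hv.of_redStep hG hS hℓ hΔ hDΔ hD hvv' with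
      ⟨hfinal, rfl⟩ | ⟨hnotfinal, ⟨L'', hv'⟩, heval'⟩
    · exact ⟨r', L', hv, .inl hfinal, heval⟩
    · have := hr'.resolve_left hnotfinal
      exact ⟨r' + 1, L'', hv', .inr (by omega), heval'.trans heval⟩
  have hP : P n w := ⟨r, L, h, .inr hr, rfl⟩
  obtain ⟨hex, hall⟩ := iterRel_of_forall_step hstep hP
  refine ⟨hex, fun v hwv => ?_⟩
  obtain ⟨r', L', hv, hr', heval⟩ := hall v hwv
  exact ⟨r', L', hv, hr'.elim id fun hr' => .inl (by simpa using hr'), heval⟩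

end IsThresholdDecomposition

end ReductionSteps

end SpindleGarside

open SpindleGarside in
theorem mainTheorem10_general {G : Type*} [Group G] {S : Set G} {Δ : G} {ℓ : G → ℤ}
    (hG : IsQuasiGarsideSystem S Δ) (hS : IsSpindleType S) (hℓ : IsLengthFun S ℓ)
    {D : Word G} (hD : IsPosWord (atoms S) D) (hDΔ : eval D = Δ)
    (p : ℤ) {ws : List (Word G)} (hws : ∀ u ∈ ws, IsPosWord (atoms S) u)
    (hLNF : IsLeftNormalForm S Δ p (ws.map eval)) :
    (∃ v, IsRed S Δ D (wordPow D p ++ ws.flatten) v) ∧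
    ∀ v, IsRed S Δ D (wordPow D p ++ ws.flatten) v →
      IsWord (atoms S) v ∧ eval v = eval (wordPow D p ++ ws.flatten) ∧
      ∀ w, IsWord (atoms S) w → eval w = eval (wordPow D p ++ ws.flatten) →
        v.length ≤ w.length := by
  have hΔ : Δ ≠ 1 := hLNF.delta_ne_one
  have hstart : IsThresholdDecomposition S Δ D (wordPow D p ++ ws.flatten) p ws :=
    (hLNF.isNormalList hG).isThresholdDecomposition hG hℓ hws hD hDΔ
  have hmin {r L} := hstart.isMinDecomposition_iff (r' := r) (L' := L) hG hS hℓ hΔ hDΔ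
  obtain ⟨⟨v, hv⟩, hfinal⟩ := hstart.iterRel_redStep hG hS hℓ hΔ hDΔ hD (n := p.natAbs) (by omega)
  refine ⟨⟨v, p, ws, hmin.2 ⟨rfl, rfl⟩, hv⟩, ?_⟩
  rintro v ⟨r, L, hdecomp, hv⟩
  obtain ⟨rfl, rfl⟩ := hmin.1 hdecomp
  obtain ⟨r', L', hv, hr', heval⟩ := hfinal v hv
  exact ⟨hv.isWord hD, heval, fun w hw hwv =>
    hv.length_le hG hS hℓ hΔ hDΔ hD hr' hw (hwv.trans heval.symm)⟩

theorem mainTheorem10 {G : Type*} [Group G] (S : Set G) (Δ : G)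
    (hG : SpindleGarside.IsGarsideSystem S Δ)
    (hspindle : SpindleGarside.IsSpindleType S)
    (hhom : SpindleGarside.HasHomogeneousPresentation S)
    (D : SpindleGarside.Word G)
    (hD : SpindleGarside.IsPosWord (SpindleGarside.atoms S) D)
    (hDΔ : SpindleGarside.eval D = Δ)
    (p : ℤ) (ws : List (SpindleGarside.Word G))
    (hws : ∀ u ∈ ws, SpindleGarside.IsPosWord (SpindleGarside.atoms S) u)
    (hLNF : SpindleGarside.IsLeftNormalForm S Δ p (ws.map SpindleGarside.eval)) :
    (∃ v, SpindleGarside.IsRed S Δ D (SpindleGarside.wordPow D p ++ ws.flatten) v) ∧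
    ∀ v, SpindleGarside.IsRed S Δ D (SpindleGarside.wordPow D p ++ ws.flatten) v →
      SpindleGarside.IsWord (SpindleGarside.atoms S) v ∧
      SpindleGarside.eval v =
        SpindleGarside.eval (SpindleGarside.wordPow D p ++ ws.flatten) ∧
      ∀ w, SpindleGarside.IsWord (SpindleGarside.atoms S) w →
        SpindleGarside.eval w =
          SpindleGarside.eval (SpindleGarside.wordPow D p ++ ws.flatten) →
        v.length ≤ w.length := by
  obtain ⟨ℓ, hℓ⟩ := hhom.exists_isLengthFun
  exact mainTheorem10_general hG.isQuasiGarsideSystem hspindle hℓ hD hDΔ p hws hLNF
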